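/- **Setup.** Let $D$ be a generic diagram in the plane of an oriented link, with numbered crossings $1,\dots,n$, of which $c_-$ are negative. For $v\in\{0,1\}^n$ let $S_v$ be the collection of disjoint circles in the plane obtained by resolving every crossing $x$ of $D$ by its $v_x$-smoothing. For a circle $c$ of $S_v$ let $\operatorname{nes}(c)$ be the number of circles of $S_v$ that contain $c$ inside. Let $R=\mathbb Z[t]$, let $A$ be the free $R$-module with basis $1,X$, and for $\varepsilon\in\{0,1\}$ let $$m_\varepsilon: 1\otimes 1\mapsto 1,\quad 1\otimes X\mapsto X,\quad X\otimes 1\mapsto(-1)^\varepsilon X,\quad X\otimes X\mapsto(-1)^\varepsilon t,$$ $$\Delta_\varepsilon: 1\mapsto X\otimes 1+(-1)^\varepsilon\,1\otimes X,\quad X\mapsto X\otimes X+(-1)^\varepsilon t\,1\otimes 1 .$$ Put $V_v=A^{\otimes S_v}$ (one tensor factor for each circle of $S_v$). The edges of the cube $\{0,1\}^n$ are the pairs $(v,x)$ with $v_x=0$; the edge $(v,x)$ leads from $v$ to the vertex obtained from $v$ by changing $v_x$ to $1$, and it is a saddle that either merges two circles or splits one circle. The nested Frobenius system $F$ assigns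 to it the map that is the identity on the factors of all circles not involved, and on the factors of the involved circles is: $m_0$, resp. $m_1$, for a merge of two circles neither of which, resp. one of which, lies inside the other; $\Delta_0$, resp. $\Delta_1$, for a split into two circles neither of which, resp. one of which, lies inside the other. If they are nested, the first factor of $A\otimes A$ belongs to the inner circle. Khovanov's TQFT $F_{\mathrm{Kh}}$ assigns $m_0$ to every merge and $\Delta_0$ to every split. With signs on the edges of the cube, the $r$-th chain group of either complex is $\bigoplus_{|v|=r+c_-}V_v$, where $|v|=\sum_x v_x$, and the differential is the signed sum of the edge maps. The complex $F_{\mathrm{Kh}}[[D]]$ is formed with the sign $(-1)^{\#\{y<x\,:\,v_y=1\}}$ on the edge $(v,x)$. A *sign assignment* for $F$ is a function $\epsilon$ from the edges of the cube to $\{\pm1\}$ such that the product of its values around a square face is $-1$ if $F$ makes the face commutative and $+1$ if $F$ makes it anticommutative; $F[[D]]_\epsilon$ is formed with the signs $\epsilon$. **Theorem 1.** Under $F$, every square face of the cube is either commutative or anticommutative, but not both, and a sign assignment for $F$ exists. The differential of $F_{\mathrm{Kh}}[[D]]$ squares to zero. For every sign assignment $\epsilon$, the differential of $F[[D]]_\epsilon$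 squares to zero, and there is an isomorphism of cochain complexes of $\mathbb Z[t]$-modules $$F[[D]]_\epsilon\;\cong\;F_{\mathrm{Kh}}[[D]]$$ which, on the summand $V_v$ for each vertex $v$, is $\eta(v)\,\phi_v$ for some sign $\eta(v)\in\{\pm1\}$, where $\phi_v$ is the tensor product over the circles $c$ of $S_v$ of the maps $1\mapsto 1$, $X\mapsto(-1)^{\operatorname{nes}(c)}X$. -/

import Mathlib

open CategoryTheory TensorProduct

noncomputable section

namespace NestedKhovanov

/-! ### Oriented link diagrams in the plane -/

/-- A signed Gauss code. There are `n` numbered crossings and `loops` circle components without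
crossings. The pair `(x, false)` is the passage along the lower strand of the crossing `x` and
`(x, true)` the passage along the upper strand; travelling along the oriented link, the passage
that follows the passage `s` is `next s`. The sign of a crossing is the usual one. -/
structure GaussCode where
  n : ℕ
  loops : ℕ
  sgn : Fin n → ℤˣ
  next : Equiv.Perm (Fin n × Bool)

namespace GaussCode

variable (G : GaussCode)

/-- The (oriented) edges of the 4-valent graph underlying the diagram: `Sum.inl s` is the edge that
ends at the passage `s`, and `Sum.inr i` is a component without crossings. -/
abbrev Edge : Type := (Fin G.n × Bool) ⊕ Fin G.loops

/-- The edge on which the passage `s` is entered. -/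
def inEdge (s : Fin G.n × Bool) : G.Edge := Sum.inl s

/-- The edge on which the passage `s` is left. -/
def outEdge (s : Fin G.n × Bool) : G.Edge := Sum.inl (G.next s)

/-- The four edge ends at the crossing `x`, counterclockwise, beginning with the incoming end of
the lower strand. The Boolean is `true` if the edge is directed away from the crossing. -/
def ends (x : Fin G.n) : Fin 4 → G.Edge × Bool :=
  if G.sgn x = 1 then
    ![(G.inEdge (x, false), false), (G.outEdge (x, true), true),
      (G.outEdge (x, false), true), (G.inEdge (x, true), false)]
  else
    ![(G.inEdge (x, false), false), (G.inEdge (x, true), false),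
      (G.outEdge (x, false), true), (G.outEdge (x, true), true)]

/-- Two edges lie on the same connected component of the underlying graph. -/
def componentSetoid : Setoid G.Edge :=
  Relation.EqvGen.setoid fun e f => ∃ x j k, e = (G.ends x j).1 ∧ f = (G.ends x k).1

/-- The number of connected components of the underlying graph. -/
def numComponents : ℕ := Nat.card (Quotient G.componentSetoid)

/-- The number of negative crossings. -/
def numNeg : ℕ := (Finset.univ.filter fun x => G.sgn x = -1).card

end GaussCode

/-- A generic diagram of an oriented link in the plane, up to planar isotopy: a signed Gauss code
together with the `m` regions of the complement of the underlying graph, the regions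
to the left and to the right of every edge, and the unbounded region `outer`.
The diagram need not be connected, and it may have components without crossings. -/
structure LinkDiagram extends GaussCode where
  m : ℕ
  left : toGaussCode.Edge → Fin m
  right : toGaussCode.Edge → Fin m
  outer : Fin m
  /-- At a crossing, the region on the counterclockwise side of an edge end is the region on the
  clockwise side of the next edge end. -/
  corner : ∀ x k,
    (if (toGaussCode.ends x k).2 then left (toGaussCode.ends x k).1
      else right (toGaussCode.ends x k).1) =
    (if (toGaussCode.ends x (k + 1)).2 then right (toGaussCode.ends x (k + 1)).1
      else left (toGaussCode.ends x (k + 1)).1)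
  /-- The surface that carries the diagram is connected. -/
  connected : ∀ r s : Fin m, Relation.EqvGen (fun r s => ∃ e, left e = r ∧ right e = s) r s
  /-- The surface that carries the diagram is a sphere: Euler's formula
  `V - E + F = 1 + C`, where `E = 2 V` since the underlying graph is 4-valent (a component without
  crossings contributes `0` to `V - E`). -/
  euler : m = n + toGaussCode.numComponents + 1

namespace LinkDiagram

variable (D : LinkDiagram)

/-- The edges of the diagram. -/
abbrev Edge : Type := D.toGaussCode.Edge

/-- The vertices of the cube of resolutions: a smoothing for every crossing, `false` for the
`0`-smoothing and `true` for the `1`-smoothing. -/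
abbrev Vertex : Type := Fin D.n → Bool

/-- The edge at the `k`-th position of the crossing `x`. -/
def edgeAt (x : Fin D.n) (k : Fin 4) : D.Edge := (D.ends x k).1

/-- The region in the corner between the `k`-th edge end of the crossing `x` and the next one. -/
def cornerAt (x : Fin D.n) (k : Fin 4) : Fin D.m :=
  if (D.ends x k).2 then D.left (D.ends x k).1 else D.right (D.ends x k).1

/-! ### Resolutions -/

/-- Two edges are joined by a smoothing: the `0`-smoothing joins the ends `0, 1` and the ends
`2, 3` of a crossing, the `1`-smoothing joins the ends `0, 3` and the ends `1, 2`. -/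
inductive Joined (v : D.Vertex) : D.Edge → D.Edge → Prop
  | zero_fst (x : Fin D.n) (h : v x = false) : Joined v (D.edgeAt x 0) (D.edgeAt x 1)
  | zero_snd (x : Fin D.n) (h : v x = false) : Joined v (D.edgeAt x 2) (D.edgeAt x 3)
  | one_fst (x : Fin D.n) (h : v x = true) : Joined v (D.edgeAt x 0) (D.edgeAt x 3)
  | one_snd (x : Fin D.n) (h : v x = true) : Joined v (D.edgeAt x 1) (D.edgeAt x 2)

/-- Two edges of the diagram lie on the same circle of the resolution `v`. -/
def circleSetoid (v : D.Vertex) : Setoid D.Edge := Relation.EqvGen.setoid (D.Joined v)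

/-- The circles of the resolution `v`; a circle is given by the set of edges it runs through. -/
abbrev Circle (v : D.Vertex) : Type := {c : Set D.Edge // c ∈ (D.circleSetoid v).classes}

/-- The circle of the resolution `v` that runs through the edge `e`. -/
def circleThrough (v : D.Vertex) (e : D.Edge) : D.Circle v :=
  ⟨{f | (D.circleSetoid v) f e}, (D.circleSetoid v).mem_classes e⟩

/-- Two regions of the diagram that can be joined by an elementary path in the complement of the
circle `c` of the resolution `v`: across an edge that does not lie on `c`, or through the channel
which the smoothing of a crossing opens between two opposite corners. -/
inductive Adjacent (v : D.Vertex) (c : D.Circle v) : Fin D.m → Fin D.m → Prop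
  | across (e : D.Edge) (h : e ∉ c.1) : Adjacent v c (D.left e) (D.right e)
  | channel_zero (x : Fin D.n) (h : v x = false) :
      Adjacent v c (D.cornerAt x 1) (D.cornerAt x 3)
  | channel_one (x : Fin D.n) (h : v x = true) :
      Adjacent v c (D.cornerAt x 0) (D.cornerAt x 2)

/-- The circle `c` lies inside the circle `c'`: it does not lie in the unbounded component of the
complement of `c'`. -/
def Inside (v : D.Vertex) (c c' : D.Circle v) : Prop :=
  c ≠ c' ∧ ∀ e ∈ c.1, ¬ Relation.EqvGen (D.Adjacent v c') (D.left e) D.outer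

/-- The number of circles of the resolution `v` that contain `c` inside. -/
def nes (v : D.Vertex) (c : D.Circle v) : ℕ := Nat.card {c' : D.Circle v // D.Inside v c c'}

end LinkDiagram

/-! ### The nested Frobenius system -/

/-- The ground ring `ℤ[t]`. -/
abbrev R : Type := Polynomial ℤ

/-- The indeterminate `t`. -/
abbrev t : R := Polynomial.X

/-- The free `ℤ[t]`-module of rank two with basis `1`, `X`. -/
abbrev A : Type := Fin 2 → R

/-- The basis `1`, `X` of `A`. -/
def bas : Module.Basis (Fin 2) R A := Pi.basisFun R (Fin 2)

/-- The basis element `1`. -/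
def one : A := bas 0

/-- The basis element `X`. -/
def X : A := bas 1

/-- The multiplication `m_ε` : `1 ⊗ 1 ↦ 1`, `1 ⊗ X ↦ X`, `X ⊗ 1 ↦ (-1) ^ ε X`,
`X ⊗ X ↦ (-1) ^ ε t`. -/
def mul (ε : ℕ) : A ⊗[R] A →ₗ[R] A :=
  (bas.tensorProduct bas).constr R fun ij =>
    (!![one, X; (-1 : R) ^ ε • X, ((-1 : R) ^ ε * t) • one] : Matrix (Fin 2) (Fin 2) A) ij.1 ij.2

/-- The comultiplication `Δ_ε` : `1 ↦ X ⊗ 1 + (-1) ^ ε 1 ⊗ X`,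
`X ↦ X ⊗ X + (-1) ^ ε t 1 ⊗ 1`. -/
def comul (ε : ℕ) : A →ₗ[R] A ⊗[R] A :=
  bas.constr R ![X ⊗ₜ[R] one + (-1 : R) ^ ε • (one ⊗ₜ[R] X),
    X ⊗ₜ[R] X + ((-1 : R) ^ ε * t) • (one ⊗ₜ[R] one)]

/-- The endomorphism `1 ↦ 1`, `X ↦ (-1) ^ k X` of `A`. -/
def rescale (k : ℕ) : A →ₗ[R] A := bas.constr R ![one, (-1 : R) ^ k • X]

/-! ### The cube of modules -/

namespace LinkDiagram

variable (D : LinkDiagram)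

/-- The tensor power of `A` indexed by the circles of the resolution `v`. -/
abbrev Space (v : D.Vertex) : Type := PiTensorProduct R fun _ : D.Circle v => A

/-- The basis of pure tensors of `1`s and `X`s. -/
def spaceBasis (v : D.Vertex) : Module.Basis (D.Circle v → Fin 2) R (D.Space v) :=
  Basis.piTensorProduct fun _ => bas

open Classical in
/-- The map induced by a saddle that merges the circles `p`, `q` of `v`:
`m_ε` on the factors of `p` and `q` (in this order), the identity on the factors of all circles
that `v` and `w` have in common. -/
def mergeMap (v w : D.Vertex) (ε : ℕ) (p q : D.Circle v) : D.Space v →ₗ[R] D.Space w :=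
  (D.spaceBasis v).constr R fun σ =>
    PiTensorProduct.tprod R fun c : D.Circle w =>
      if h : c.1 ∈ (D.circleSetoid v).classes then bas (σ ⟨c.1, h⟩)
      else mul ε (bas (σ p) ⊗ₜ[R] bas (σ q))

open Classical in
/-- The map induced by a saddle that splits the circle `p` of `v` into the
circles `p'`, `q'` of `w`: `Δ_ε` from the factor of `p` to the factors of `p'` and `q'` (in this
order), the identity on the factors of all circles that `v` and `w` have in common. -/
def splitMap (v w : D.Vertex) (ε : ℕ) (p : D.Circle v) (p' q' : D.Circle w) :
    D.Space v →ₗ[R] D.Space w :=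
  (D.spaceBasis v).constr R fun σ =>
    (bas.tensorProduct bas).constr R (fun ij : Fin 2 × Fin 2 =>
      PiTensorProduct.tprod R fun c : D.Circle w =>
        if h : c.1 ∈ (D.circleSetoid v).classes then bas (σ ⟨c.1, h⟩)
        else if c = p' then bas ij.1 else if c = q' then bas ij.2 else one)
      (comul ε (bas (σ p)))

/-- The circle of the resolution `v` through the first of the two arcs at the crossing `x`, namely
the arc that contains the incoming end of the lower strand. -/
def arcFst (v : D.Vertex) (x : Fin D.n) : D.Circle v := D.circleThrough v (D.edgeAt x 0)

/-- The circle of the resolution `v` through the second of the two arcs at the crossing `x`,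
namely the arc that contains the outgoing end of the lower strand. -/
def arcSnd (v : D.Vertex) (x : Fin D.n) : D.Circle v := D.circleThrough v (D.edgeAt x 2)

open Classical in
/-- `1` if one of the two circles at the crossing `x` lies inside the other one, otherwise `0`. -/
def nestedAt (v : D.Vertex) (x : Fin D.n) : ℕ :=
  if D.Inside v (D.arcFst v x) (D.arcSnd v x) ∨ D.Inside v (D.arcSnd v x) (D.arcFst v x)
  then 1 else 0

open Classical in
/-- The two circles at the crossing `x`, the inner one first if they are nested. -/
def innerOuter (v : D.Vertex) (x : Fin D.n) : D.Circle v × D.Circle v :=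
  if D.Inside v (D.arcSnd v x) (D.arcFst v x) then (D.arcSnd v x, D.arcFst v x)
  else (D.arcFst v x, D.arcSnd v x)

/-- The end point of the edge of the cube that starts at `v` and changes the smoothing of `x` from
`0` to `1`. -/
abbrev flip (v : D.Vertex) (x : Fin D.n) : D.Vertex := Function.update v x true

open Classical in
/-- The nested system on the saddle at the crossing `x` from the resolution `v` to the resolution
`w`: `m_0` for a merge of two circles that are not nested, `m_1` for a merge of two nested circles,
`Δ_0` for a split into two circles that are not nested, and `Δ_1` for a split into two nested
circles. The first tensor factor belongs to the inner circle. -/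
def nestedSaddle (x : Fin D.n) (v w : D.Vertex) : D.Space v →ₗ[R] D.Space w :=
  if D.arcFst v x ≠ D.arcSnd v x then
    D.mergeMap v w (D.nestedAt v x) (D.innerOuter v x).1 (D.innerOuter v x).2
  else
    D.splitMap v w (D.nestedAt w x) (D.arcFst v x) (D.innerOuter w x).1 (D.innerOuter w x).2

open Classical in
/-- Khovanov's TQFT on the saddle at the crossing `x` from the resolution `v` to the resolution
`w`: `m_0` for a merge and `Δ_0` for a split. -/
def khSaddle (x : Fin D.n) (v w : D.Vertex) : D.Space v →ₗ[R] D.Space w :=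
  if D.arcFst v x ≠ D.arcSnd v x then D.mergeMap v w 0 (D.arcFst v x) (D.arcSnd v x)
  else D.splitMap v w 0 (D.arcFst v x) (D.arcFst w x) (D.arcSnd w x)

/-- The face of the cube at `v` in the directions `x`, `y` becomes commutative after applying the
nested system. -/
def FaceCommutes (v : D.Vertex) (x y : Fin D.n) : Prop :=
  D.nestedSaddle y (D.flip v x) (D.flip (D.flip v x) y) ∘ₗ D.nestedSaddle x v (D.flip v x) =
  D.nestedSaddle x (D.flip v y) (D.flip (D.flip v x) y) ∘ₗ D.nestedSaddle y v (D.flip v y)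

/-- The face of the cube at `v` in the directions `x`, `y` becomes anticommutative after applying
the nested system. -/
def FaceAnticommutes (v : D.Vertex) (x y : Fin D.n) : Prop :=
  D.nestedSaddle y (D.flip v x) (D.flip (D.flip v x) y) ∘ₗ D.nestedSaddle x v (D.flip v x) =
  -(D.nestedSaddle x (D.flip v y) (D.flip (D.flip v x) y) ∘ₗ D.nestedSaddle y v (D.flip v y))

/-- A sign assignment for the nested system. The edge of the cube from `v` to `flip v x`, where
`v x = false`, has the sign `ε v x`; the other values of `ε` play no role. The product of the four
signs around a face is `-1` if the face commutes and `1` if it anticommutes. -/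
def IsSignAssignment (ε : D.Vertex → Fin D.n → ℤˣ) : Prop :=
  ∀ v x y, x ≠ y → v x = false → v y = false →
    (D.FaceCommutes v x y → ε v x * ε (D.flip v x) y * (ε v y * ε (D.flip v y) x) = -1) ∧
    (D.FaceAnticommutes v x y → ε v x * ε (D.flip v x) y * (ε v y * ε (D.flip v y) x) = 1)

/-- The standard signs of the cube: an edge gets a minus sign if its label has an odd number of
`1`s before the letter that changes. -/
def standardSign (v : D.Vertex) (x : Fin D.n) : ℤˣ :=
  (-1) ^ (Finset.univ.filter fun y => y < x ∧ v y = true).card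

/-! ### The complexes -/

/-- The height of a vertex of the cube: the number of `1`-smoothings. -/
def height (v : D.Vertex) : ℕ := (Finset.univ.filter fun x => v x = true).card

lemma height_flip (v : D.Vertex) (x : Fin D.n) (h : v x = false) :
    D.height (D.flip v x) = D.height v + 1 := by
  have : (Finset.univ.filter fun y => D.flip v x y = true) =
      insert x (Finset.univ.filter fun y => v y = true) := by
    ext y
    by_cases hy : y = x
    · subst hy; simp
    · simp [hy]
  rw [height, this, Finset.card_insert_of_notMem (by simp [h])]
  rfl

/-- The vertices of the cube that contribute to the degree `r`, which is the height minus the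
number of negative crossings. -/
abbrev VertexIn (r : ℤ) : Type := {v : D.Vertex // (D.height v : ℤ) - D.numNeg = r}

/-- The chain group in degree `r`. -/
abbrev Chain (r : ℤ) : Type := DirectSum (D.VertexIn r) fun v => D.Space v.1

/-- The inclusion of the module at the vertex `v` into the chain group. -/
def incl (r : ℤ) (v : D.VertexIn r) : D.Space v.1 →ₗ[R] D.Chain r :=
  DirectSum.lof R (D.VertexIn r) (fun v => D.Space v.1) v

/-- The end point of an edge of the cube lies in the next degree. -/
def flipIn {r : ℤ} (v : D.VertexIn r) (x : Fin D.n) (h : v.1 x = false) : D.VertexIn (r + 1) :=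
  ⟨D.flip v.1 x, by have := v.2; rw [D.height_flip v.1 x h]; push_cast; linarith⟩

/-- The differential of the cube with the maps `f` on the edges, multiplied with the signs `ε`. -/
def diff (f : ∀ (_ : Fin D.n) (v w : D.Vertex), D.Space v →ₗ[R] D.Space w)
    (ε : D.Vertex → Fin D.n → ℤˣ) (r : ℤ) : D.Chain r →ₗ[R] D.Chain (r + 1) :=
  DirectSum.toModule R (D.VertexIn r) (D.Chain (r + 1)) fun v => ∑ x : Fin D.n,
    if h : v.1 x = false then
      ((ε v.1 x : ℤ) : R) • (D.incl (r + 1) (D.flipIn v x h) ∘ₗ f x v.1 (D.flip v.1 x))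
    else 0

/-- The square of the differential is zero. -/
def IsComplex (f : ∀ (_ : Fin D.n) (v w : D.Vertex), D.Space v →ₗ[R] D.Space w)
    (ε : D.Vertex → Fin D.n → ℤˣ) : Prop :=
  ∀ r, D.diff f ε (r + 1) ∘ₗ D.diff f ε r = 0

/-- The cochain complex of `ℤ[t]`-modules obtained from the cube. -/
def cubeComplex (f : ∀ (_ : Fin D.n) (v w : D.Vertex), D.Space v →ₗ[R] D.Space w)
    (ε : D.Vertex → Fin D.n → ℤˣ) (h : D.IsComplex f ε) : CochainComplex (ModuleCat.{0} R) ℤ :=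
  CochainComplex.of (fun r => ModuleCat.of R (D.Chain r)) (fun r => ModuleCat.ofHom (D.diff f ε r))
    fun r => by rw [← ModuleCat.ofHom_comp, h r]; rfl

/-- The complex of the diagram for the nested system with the signs `ε`. -/
def nestedComplex (ε : D.Vertex → Fin D.n → ℤˣ) (h : D.IsComplex D.nestedSaddle ε) :
    CochainComplex (ModuleCat.{0} R) ℤ :=
  D.cubeComplex D.nestedSaddle ε h

/-- Khovanov's complex of the diagram. -/
def khComplex (h : D.IsComplex D.khSaddle D.standardSign) :
    CochainComplex (ModuleCat.{0} R) ℤ :=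
  D.cubeComplex D.khSaddle D.standardSign h

/-- The endomorphism of the module at the vertex `v` that multiplies the `X` in the factor of each
circle `c` by `(-1) ^ nes c`. -/
def phi (v : D.Vertex) : D.Space v →ₗ[R] D.Space v :=
  PiTensorProduct.map fun c => rescale (D.nes v c)

end LinkDiagram

end NestedKhovanov

end

noncomputable section
namespace NestedKhovanov

/-! ### Potentials of cycles -/

namespace GaussCode

variable (G : GaussCode)

/-! The maps `phi` conjugate the nested system into Khovanov's, up to one sign per edge of the cube;
the rest is cohomology of the cube with values in ±1.

Algebra. Each vertex module is generated from 1 ⊗ ... ⊗ 1 by multiplications by the X of single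
circles. Label such a multiplication by a diagram edge on the circle, so that it makes sense before
and after a saddle. Every map in play commutes with these multiplications up to a sign depending on
the diagram edge (`Intertwines`), and it is determined by these signs and its value on 1 ⊗ ... ⊗ 1
(`Intertwines.ext`). Khovanov's saddles have trivial signs, `phi` has the parity of nesting, and a
nested saddle has the change of that parity (`intertwines_nestedSaddle`). So both ways around the
square formed by `phi` and the two saddles have the same signs, and comparing values on 1 ⊗ ... ⊗ 1
gives agreement up to a sign `edgeSign` (`exists_phi_comp_nestedSaddle`).

Topology. Planarity enters through Euler's formula: a dimension count over `ZMod 2` shows that every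
even set of edges bounds (`range_coboundary`), a discrete Jordan curve theorem. The resulting
potential of a circle is 1 inside and 0 outside. Since the potentials of all circles of a resolution
add up to a function independent of the resolution (`sum_pot`), nesting parity can be read off in
one region (`natCast_nes`), and its change under a saddle is a computation in one corner
(`Merges.natCast_nes_innerOuter`). Potentials also show that each saddle is a merge or a split
(`not_off_zero_two`, `merges_or_merges`).

Signs. Khovanov's faces commute and are nonzero in characteristic zero, so a nested face commutes or
anticommutes according to the product of its four values of `edgeSign` (`face_iff`). A sign
assignment times `edgeSign` times the standard signs is a 1-cocycle on the cube, hence the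
coboundary of some η (`exists_eq_mul_of_cocycle`), and η · `phi` is the isomorphism. -/

lemma sum_ends {M : Type*} [AddCommMonoid M] (x : Fin G.n) (z : G.Edge → M) :
    ∑ k, z (G.ends x k).1 = ∑ b, (z (Sum.inl (x, b)) + z (Sum.inl (G.next (x, b)))) := by
  unfold ends
  split_ifs <;> simp [Fin.sum_univ_four, inEdge, outEdge] <;> abel

/-- The boundary operator of the underlying graph modulo `2`. -/
def boundary : (G.Edge → ZMod 2) →ₗ[ZMod 2] (Fin G.n → ZMod 2) where
  toFun z x := ∑ k, z (G.ends x k).1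
  map_add' z w := by ext x; simp [Finset.sum_add_distrib]
  map_smul' a z := by ext x; simp [Finset.mul_sum]

lemma boundary_apply (z : G.Edge → ZMod 2) (x : Fin G.n) :
    G.boundary z x = ∑ k, z (G.ends x k).1 := rfl

/-- Adjunction: the transpose of the boundary adds the values of `g` at the two end points of an
edge. Loops have no end points and drop out. -/
lemma sum_mul_boundary (g : Fin G.n → ZMod 2) (z : G.Edge → ZMod 2) :
    ∑ x, g x * G.boundary z x =
      ∑ s, z (Sum.inl s) * (g s.1 + g (G.next.symm s).1) := by
  have h : ∑ s, z (Sum.inl s) * g (G.next.symm s).1 =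
      ∑ s : Fin G.n × Bool, z (Sum.inl (G.next s)) * g s.1 := by
    rw [← Equiv.sum_comp G.next]
    simp
  simp only [mul_add, Finset.sum_add_distrib, h]
  rw [← Finset.sum_add_distrib, Fintype.sum_prod_type]
  refine Finset.sum_congr rfl fun x _ => ?_
  rw [boundary_apply, sum_ends, Finset.mul_sum]
  exact Finset.sum_congr rfl fun b _ => by ring

lemma ends_fst (x : Fin G.n) (k : Fin 4) :
    ∃ b, (G.ends x k).1 = Sum.inl (x, b) ∨ (G.ends x k).1 = Sum.inl (G.next (x, b)) := by
  unfold ends inEdge outEdge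
  split_ifs <;> fin_cases k <;> simp

/-- The kernel consists of functions on crossings that agree along every edge. Together with
arbitrary values on the crossingless loops they inject into the functions on the set of components.
-/
lemma finrank_ker_transpose_le :
    Module.finrank (ZMod 2) (LinearMap.ker (LinearMap.toMatrix' G.boundary).transpose.mulVecLin)
      + G.loops ≤ G.numComponents := by
  classical
  set K := LinearMap.ker (LinearMap.toMatrix' G.boundary).transpose.mulVecLin
  -- Pair `g` with the boundary of the single edge that runs from the passage `s` to the next one.
  have hK : ∀ g ∈ K, ∀ s : Fin G.n × Bool, g (G.next s).1 = g s.1 := by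
    intro g hg s
    have h := congrFun (LinearMap.mem_ker.1 hg) (Sum.inl (G.next s))
    have h2 := G.sum_mul_boundary g (Pi.single (Sum.inl (G.next s)) 1)
    rw [Finset.sum_eq_single (G.next s)] at h2
    · have h3 : ∑ x, g x * G.boundary (Pi.single (Sum.inl (G.next s)) 1) x = 0 := by
        rw [← Pi.zero_apply (M := fun _ => ZMod 2) (Sum.inl (G.next s) : G.Edge), ← h]
        simp [Matrix.vecMul, dotProduct, LinearMap.toMatrix'_apply]
      rw [h3] at h2
      simp only [Pi.single_eq_same, one_mul, Equiv.symm_apply_apply] at h2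
      exact CharTwo.add_eq_zero.1 h2.symm
    · intro b _ hb
      rw [Pi.single_eq_of_ne (by simpa using hb), zero_mul]
    · simp
  let ext : (K × (Fin G.loops → ZMod 2)) → G.Edge → ZMod 2 := fun p e =>
    Sum.elim (fun s => p.1.1 s.1) p.2 e
  have hext : ∀ p x k, ext p (G.ends x k).1 = p.1.1 x := by
    intro p x k
    obtain ⟨b, h | h⟩ := G.ends_fst x k
    · simp [ext, h]
    · simp [ext, h, hK p.1.1 p.1.2 (x, b)]
  have hcomp : ∀ p e f, G.componentSetoid e f → ext p e = ext p f := by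
    intro p e f h
    induction h with
    | rel _ _ h => obtain ⟨x, j, k, rfl, rfl⟩ := h; rw [hext, hext]
    | refl => rfl
    | symm _ _ _ h => exact h.symm
    | trans _ _ _ _ _ h h' => exact h.trans h'
  let Ψ : (K × (Fin G.loops → ZMod 2)) →ₗ[ZMod 2] (Quotient G.componentSetoid → ZMod 2) :=
    { toFun := fun p q => Quotient.lift (ext p) (hcomp p) q
      map_add' := fun p p' => by
        ext q; induction q using Quotient.inductionOn with | _ e => cases e <;> simp [ext]
      map_smul' := fun a p => by
        ext q; induction q using Quotient.inductionOn with | _ e => cases e <;> simp [ext] }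
  have hΨ : Function.Injective Ψ := by
    intro p p' h
    have h' : ∀ e, ext p e = ext p' e := fun e => congrFun h (Quotient.mk _ e)
    refine Prod.ext (Subtype.ext (funext fun x => ?_)) (funext fun i => ?_)
    · exact h' (Sum.inl (x, false))
    · exact h' (Sum.inr i)
  have := LinearMap.finrank_le_finrank_of_injective hΨ
  simpa [numComponents] using this

/-- There are 2n + loops edges, and the rank is n minus the dimension of the kernel of the
transpose, because row rank equals column rank. -/
lemma finrank_ker_boundary_le :
    Module.finrank (ZMod 2) (LinearMap.ker G.boundary) ≤ G.n + G.numComponents := by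
  have h1 := LinearMap.finrank_range_add_finrank_ker G.boundary
  have h2 := LinearMap.finrank_range_add_finrank_ker
    (LinearMap.toMatrix' G.boundary).transpose.mulVecLin
  have h3 : Module.finrank (ZMod 2) (LinearMap.range
      (LinearMap.toMatrix' G.boundary).transpose.mulVecLin) =
      Module.finrank (ZMod 2) (LinearMap.range G.boundary) := by
    change Matrix.rank _ = _
    rw [Matrix.rank_transpose, Matrix.rank, ← Matrix.toLin'_apply', Matrix.toLin'_toMatrix']
  have h4 := G.finrank_ker_transpose_le
  simp only [Module.finrank_fintype_fun_eq_card, Fintype.card_sum, Fintype.card_prod,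
    Fintype.card_fin, Fintype.card_bool] at h1 h2
  omega

end GaussCode

namespace LinkDiagram

variable (D : LinkDiagram)

/-- The coboundary operator modulo `2` from regions to edges. -/
def coboundary : (Fin D.m → ZMod 2) →ₗ[ZMod 2] (D.Edge → ZMod 2) where
  toFun f e := f (D.left e) + f (D.right e)
  map_add' f g := by ext e; simp; ring
  map_smul' a f := by ext e; simp; ring

lemma coboundary_apply (f : Fin D.m → ZMod 2) (e : D.Edge) :
    D.coboundary f e = f (D.left e) + f (D.right e) := rfl

lemma cornerAt_succ (x : Fin D.n) (k : Fin 4) :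
    D.cornerAt x k = if (D.ends x (k + 1)).2 then D.right (D.ends x (k + 1)).1
      else D.left (D.ends x (k + 1)).1 := D.corner x k

lemma coboundary_edgeAt (f : Fin D.m → ZMod 2) (x : Fin D.n) (k : Fin 4) :
    D.coboundary f (D.edgeAt x (k + 1)) = f (D.cornerAt x k) + f (D.cornerAt x (k + 1)) := by
  rw [cornerAt_succ, coboundary_apply, cornerAt, edgeAt]
  split_ifs
  · rw [add_comm]
  · rfl

lemma boundary_coboundary (f : Fin D.m → ZMod 2) : D.boundary (D.coboundary f) = 0 := by
  ext x
  have h : ∀ k, D.coboundary f (D.ends x (k + 1)).1 =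
    f (D.cornerAt x k) + f (D.cornerAt x (k + 1)) := D.coboundary_edgeAt f x
  have h' := Equiv.sum_comp (Equiv.addRight (1 : Fin 4)) fun k => f (D.cornerAt x k)
  rw [Equiv.coe_addRight] at h'
  rw [GaussCode.boundary_apply, ← Equiv.sum_comp (Equiv.addRight (1 : Fin 4))]
  simp only [Equiv.coe_addRight, h, Finset.sum_add_distrib, h']
  exact CharTwo.add_self_eq_zero _

lemma eq_of_coboundary_eq_zero {f : Fin D.m → ZMod 2} (hf : D.coboundary f = 0)
    (r s : Fin D.m) : f r = f s := by
  induction D.connected r s with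
  | rel _ _ h =>
    obtain ⟨e, rfl, rfl⟩ := h
    exact CharTwo.add_eq_zero.1 (congrFun hf e)
  | refl => rfl
  | symm _ _ _ h => exact h.symm
  | trans _ _ _ _ _ h h' => exact h.trans h'

/-- One inclusion is `boundary_coboundary`. For equality of dimensions, the kernel of the coboundary
contains only constants since the surface is connected, so the range has dimension at least m - 1,
which is n + C by Euler's formula and bounds the dimension of the cycle space. -/
lemma range_coboundary : LinearMap.range D.coboundary = LinearMap.ker D.boundary := by
  refine Submodule.eq_of_le_of_finrank_le ?_ ?_
  · rintro _ ⟨f, rfl⟩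
    exact D.boundary_coboundary f
  · have h1 := LinearMap.finrank_range_add_finrank_ker D.coboundary
    have h2 : Module.finrank (ZMod 2) (LinearMap.ker D.coboundary) ≤ 1 := by
      refine finrank_le_one ⟨fun _ => 1, ?_⟩ fun f => ⟨f.1 D.outer, ?_⟩
      · ext e; exact CharTwo.add_self_eq_zero 1
      · ext r
        simpa using D.eq_of_coboundary_eq_zero f.2 D.outer r
    have h4 := D.euler
    refine D.finrank_ker_boundary_le.trans ?_
    simp only [Module.finrank_fintype_fun_eq_card, Fintype.card_fin] at h1
    omega

/-- A set of edges is even if it contains an even number of edge ends at every crossing. -/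
def IsEven (S : Set D.Edge) : Prop :=
  ∀ x, ∑ k, S.indicator (1 : D.Edge → ZMod 2) (D.edgeAt x k) = 0

/-- A function on the regions that changes exactly across the edges of `S`. -/
def IsPotential (S : Set D.Edge) (f : Fin D.m → ZMod 2) : Prop :=
  f D.outer = 0 ∧ D.coboundary f = S.indicator 1

lemma IsEven.exists_isPotential {S : Set D.Edge} (hS : D.IsEven S) : ∃ f, D.IsPotential S f := by
  have h : S.indicator (1 : D.Edge → ZMod 2) ∈ LinearMap.range D.coboundary := by
    rw [range_coboundary]
    exact funext hS
  obtain ⟨f, hf⟩ := h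
  -- Adding a constant normalizes the potential at the unbounded region without changing its
  -- coboundary.
  refine ⟨fun r => f r + f D.outer, CharTwo.add_self_eq_zero _, ?_⟩
  rw [← hf]
  ext e
  rw [coboundary_apply, coboundary_apply, add_add_add_comm, CharTwo.add_self_eq_zero, add_zero]

variable {D}

lemma eq_of_coboundary_eq {f g : Fin D.m → ZMod 2} (hf : f D.outer = g D.outer)
    (h : D.coboundary f = D.coboundary g) : f = g := by
  ext r
  have := D.eq_of_coboundary_eq_zero (f := f - g) (by rw [map_sub, h, sub_self]) r D.outer
  simpa [hf, sub_eq_zero] using this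

lemma IsPotential.unique {S : Set D.Edge} {f g : Fin D.m → ZMod 2} (hf : D.IsPotential S f)
    (hg : D.IsPotential S g) : f = g :=
  eq_of_coboundary_eq (hf.1.trans hg.1.symm) (hf.2.trans hg.2.symm)

variable (D) in
open Classical in
/-- The potential of an even set of edges that vanishes on the unbounded region. -/
def pot (S : Set D.Edge) : Fin D.m → ZMod 2 :=
  if h : ∃ f, D.IsPotential S f then h.choose else 0

lemma IsPotential.pot_eq {S : Set D.Edge} {f : Fin D.m → ZMod 2} (hf : D.IsPotential S f) :
    D.pot S = f := by
  rw [pot, dif_pos ⟨f, hf⟩]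
  exact (Exists.choose_spec (⟨f, hf⟩ : ∃ f, D.IsPotential S f)).unique hf

lemma IsEven.isPotential_pot {S : Set D.Edge} (hS : D.IsEven S) : D.IsPotential S (D.pot S) := by
  obtain ⟨f, hf⟩ := hS.exists_isPotential
  rwa [hf.pot_eq]

lemma IsEven.pot_outer {S : Set D.Edge} (hS : D.IsEven S) : D.pot S D.outer = 0 :=
  hS.isPotential_pot.1

lemma IsEven.pot_left_right_of_mem {S : Set D.Edge} (hS : D.IsEven S) {e : D.Edge} (he : e ∈ S) :
    D.pot S (D.left e) + D.pot S (D.right e) = 1 := by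
  rw [← coboundary_apply, hS.isPotential_pot.2]; simp [he]

lemma IsEven.pot_left_eq_right {S : Set D.Edge} (hS : D.IsEven S) {e : D.Edge} (he : e ∉ S) :
    D.pot S (D.left e) = D.pot S (D.right e) := by
  rw [← CharTwo.add_eq_zero, ← coboundary_apply, hS.isPotential_pot.2]; simp [he]

end LinkDiagram

/-! ### Pairs of involutions -/

section Involutions

variable {Ω : Type*} {α β : Equiv.Perm Ω}

/-- Dihedral relation: conjugation by `β` inverts `α * β`. -/
lemma apply_zpow_mul_of_fixed (hα : α * α = 1) (hβ : β * β = 1) {a : Ω} (ha : β a = a) (k : ℤ) :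
    β (((α * β) ^ k) a) = ((α * β) ^ (-k)) a := by
  have h : β * (α * β) * β⁻¹ = (α * β)⁻¹ := by
    rw [mul_inv_rev, inv_eq_of_mul_eq_one_left hα, inv_eq_of_mul_eq_one_left hβ, mul_assoc,
      mul_assoc, hβ, mul_one]
  have h' := conj_zpow (i := k) (a := β) (b := α * β)
  rw [h, inv_zpow'] at h'
  rw [h']
  simp only [Equiv.Perm.mul_apply]
  rw [Equiv.Perm.inv_eq_iff_eq.2 ha.symm]

lemma apply_zpow_mul_of_fixed' (hα : α * α = 1) (hβ : β * β = 1) {a : Ω} (ha : β a = a) (k : ℤ) :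
    α (((α * β) ^ k) a) = ((α * β) ^ (1 - k)) a := by
  have h : ∀ y, β (β y) = y := fun y => by rw [← Equiv.Perm.mul_apply, hβ, Equiv.Perm.one_apply]
  rw [sub_eq_add_neg, zpow_add, zpow_one, Equiv.Perm.mul_apply,
    ← apply_zpow_mul_of_fixed hα hβ ha, Equiv.Perm.mul_apply, h]

/-- If `α` is an involution without fixed points, then an orbit of the group generated by `α` and
the involution `β` that contains a fixed point of `β` contains exactly two of them. -/
lemma exists_unique_other_fixed [Finite Ω] (hα : α * α = 1) (hβ : β * β = 1) (hfix : ∀ a, α a ≠ a)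
    {a : Ω} (ha : β a = a) :
    ∃ b, b ≠ a ∧ β b = b ∧ (α * β).SameCycle a b ∧
      ∀ c, (α * β).SameCycle a c → β c = c → c = a ∨ c = b := by
  set π := α * β
  obtain ⟨N, hN⟩ : ∃ N : ℕ, ∀ k : ℤ, (π ^ k) a = a ↔ (N : ℤ) ∣ k :=
    ⟨_, fun k => MulAction.zpow_smul_eq_iff_minimalPeriod_dvd (a := π) (b := a)⟩
  have hN' : ∀ k l : ℤ, (π ^ k) a = (π ^ l) a ↔ (N : ℤ) ∣ k - l := by
    intro k l
    rw [← hN, sub_eq_neg_add, zpow_add, zpow_neg, Equiv.Perm.mul_apply, Equiv.Perm.inv_eq_iff_eq]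
  have hpos : 0 < N := by
    refine Nat.pos_of_ne_zero fun h0 => ?_
    have h1 := (hN (orderOf π)).1 (by simp [pow_orderOf_eq_one])
    rw [h0] at h1
    have h2 := orderOf_pos π
    have : (orderOf π : ℤ) = 0 := by simpa using h1
    omega
  -- On the cycle of length N, `β` acts as the reflection k ↦ -k and `α` as k ↦ 1 - k. For N = 2m
  -- the fixed points of `β` are k = 0 and k = m. For N = 2m + 1 the reflection `α` would fix k = m
  -- + 1, which is excluded.
  obtain ⟨m, hm | hm⟩ := Nat.even_or_odd' N
  · have hβm : ∀ k : ℤ, β ((π ^ k) a) = (π ^ k) a ↔ (m : ℤ) ∣ k := by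
      intro k
      rw [apply_zpow_mul_of_fixed hα hβ ha, hN', hm]
      push_cast
      rw [show -k - k = 2 * -k by ring, mul_dvd_mul_iff_left two_ne_zero, dvd_neg]
    refine ⟨(π ^ (m : ℤ)) a, fun h => ?_, (hβm m).2 dvd_rfl, ⟨m, rfl⟩, ?_⟩
    · have := Int.le_of_dvd (by omega) ((hN m).1 h)
      omega
    · rintro _ ⟨k, rfl⟩ hk
      obtain ⟨j, rfl⟩ := (hβm k).1 hk
      rw [hN, hN', hm]
      push_cast
      obtain ⟨i, rfl | rfl⟩ := Int.even_or_odd' j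
      · exact Or.inl ⟨i, by ring⟩
      · exact Or.inr ⟨i, by ring⟩
  · refine absurd ?_ (hfix ((π ^ (m + 1 : ℤ)) a))
    rw [apply_zpow_mul_of_fixed' hα hβ ha, hN', hm]
    exact ⟨-1, by push_cast; ring⟩

/-- Through a fixed point of `β`, the cycle of `α * β` is already a full orbit of the group
generated by `α` and `β`. -/
lemma sameCycle_apply_left (hα : α * α = 1) (hβ : β * β = 1) {a : Ω} (ha : β a = a) {c : Ω}
    (hc : (α * β).SameCycle a c) : (α * β).SameCycle a (α c) := by
  obtain ⟨k, rfl⟩ := hc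
  rw [apply_zpow_mul_of_fixed' hα hβ ha]
  exact ⟨_, rfl⟩

lemma sameCycle_apply_right (hα : α * α = 1) (hβ : β * β = 1) {a : Ω} (ha : β a = a) {c : Ω}
    (hc : (α * β).SameCycle a c) : (α * β).SameCycle a (β c) := by
  obtain ⟨k, rfl⟩ := hc
  rw [apply_zpow_mul_of_fixed hα hβ ha]
  exact ⟨_, rfl⟩

lemma rel_of_sameCycle [Finite Ω] (S : Setoid Ω) (hα : ∀ a, S a (α a)) (hβ : ∀ a, S a (β a))
    {a c : Ω} (h : (α * β).SameCycle a c) : S a c := by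
  obtain ⟨k, rfl⟩ := h.exists_nat_pow_eq
  induction k with
  | zero => exact S.refl a
  | succ k ih =>
    rw [pow_succ', Equiv.Perm.mul_apply, Equiv.Perm.mul_apply]
    exact S.trans (ih ⟨k, by simp⟩) (S.trans (hβ _) (hα _))

end Involutions

/-! ### The edge ends of a diagram -/

namespace GaussCode

variable (G : GaussCode)

/-- The edge end at the position `k` of the crossing `x`: the edge ending at a passage together
with the Boolean of `ends`. -/
def endAt (d : Fin G.n × Fin 4) : (Fin G.n × Bool) × Bool :=
  if G.sgn d.1 = 1 then
    ![((d.1, false), false), (G.next (d.1, true), true),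
      (G.next (d.1, false), true), ((d.1, true), false)] d.2
  else
    ![((d.1, false), false), ((d.1, true), false),
      (G.next (d.1, false), true), (G.next (d.1, true), true)] d.2

lemma ends_eq_endAt (x : Fin G.n) (k : Fin 4) :
    G.ends x k = (Sum.inl (G.endAt (x, k)).1, (G.endAt (x, k)).2) := by
  unfold ends endAt inEdge outEdge
  dsimp only
  split_ifs <;> fin_cases k <;> rfl

lemma endAt_surjective : Function.Surjective G.endAt := by
  rintro ⟨s, b⟩
  obtain ⟨⟨x, c⟩, hx⟩ : ∃ p, (if b then G.next p else p) = s := by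
    cases b
    · exact ⟨s, rfl⟩
    · exact ⟨G.next.symm s, by simp⟩
  by_cases h : G.sgn x = 1
  · cases b <;> cases c
    · exact ⟨(x, 0), by simp_all [endAt]⟩
    · exact ⟨(x, 3), by simp_all [endAt]⟩
    · exact ⟨(x, 2), by simp_all [endAt]⟩
    · exact ⟨(x, 1), by simp_all [endAt]⟩
  · cases b <;> cases c
    · exact ⟨(x, 0), by simp_all [endAt]⟩
    · exact ⟨(x, 1), by simp_all [endAt]⟩
    · exact ⟨(x, 2), by simp_all [endAt]⟩
    · exact ⟨(x, 3), by simp_all [endAt]⟩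

/-- Edge ends are in bijection with pairs of an edge and one of its two directions. -/
def endEquiv : (Fin G.n × Fin 4) ≃ (Fin G.n × Bool) × Bool :=
  Equiv.ofBijective G.endAt <|
    (Fintype.bijective_iff_surjective_and_card _).2
      ⟨G.endAt_surjective, by simp [mul_assoc]⟩

/-- The other end of an edge. -/
def otherEnd : Equiv.Perm (Fin G.n × Fin 4) :=
  (G.endEquiv.trans ((Equiv.refl _).prodCongr Equiv.boolNot)).trans G.endEquiv.symm

lemma endEquiv_otherEnd (d : Fin G.n × Fin 4) :
    G.endEquiv (G.otherEnd d) = ((G.endEquiv d).1, !(G.endEquiv d).2) := by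
  simp only [otherEnd, Equiv.trans_apply, Equiv.apply_symm_apply]
  rfl

lemma otherEnd_mul_self : G.otherEnd * G.otherEnd = 1 := by
  ext1 d
  apply G.endEquiv.injective
  simp [endEquiv_otherEnd]

lemma otherEnd_ne (d : Fin G.n × Fin 4) : G.otherEnd d ≠ d := by
  intro h
  have := congrArg (fun d => (G.endEquiv d).2) h
  simp [endEquiv_otherEnd] at this

lemma eq_or_eq_otherEnd_iff (d d' : Fin G.n × Fin 4) :
    (G.ends d.1 d.2).1 = (G.ends d'.1 d'.2).1 ↔ d' = d ∨ d' = G.otherEnd d := by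
  rw [ends_eq_endAt, ends_eq_endAt, ← G.endEquiv.injective.eq_iff, ← G.endEquiv.injective.eq_iff,
    endEquiv_otherEnd]
  change Sum.inl (G.endEquiv d).1 = Sum.inl (G.endEquiv d').1 ↔ _
  rw [Sum.inl_injective.eq_iff]
  generalize G.endEquiv d = p, G.endEquiv d' = q
  obtain ⟨p, b⟩ := p
  obtain ⟨q, c⟩ := q
  cases b <;> cases c <;> simp [eq_comm]

end GaussCode

/-- The position that the `0`-smoothing, resp. the `1`-smoothing, joins with the position `k`. -/
def smooth (b : Bool) (k : Fin 4) : Fin 4 := if b then ![3, 2, 1, 0] k else ![1, 0, 3, 2] k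

lemma smooth_smooth (b : Bool) (k : Fin 4) : smooth b (smooth b k) = k := by
  revert b k; decide

namespace LinkDiagram

variable (D : LinkDiagram)

/-! ### Circles of a resolution and of a tangle obtained by removing a crossing -/

/-- Two edges lie on the same circle of a resolution. -/
abbrev rel (v : D.Vertex) : Setoid D.Edge := D.circleSetoid v

/-- Two edges are joined by the smoothing `v` of the crossings different from `x`. -/
def offSetoid (v : D.Vertex) (x : Fin D.n) : Setoid D.Edge :=
  Relation.EqvGen.setoid fun e f => ∃ y k, y ≠ x ∧ e = D.edgeAt y k ∧
    f = D.edgeAt y (smooth (v y) k)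

variable {D} {v w : D.Vertex} {x : Fin D.n}

lemma rel_smooth (v : D.Vertex) (y : Fin D.n) (k : Fin 4) :
    D.rel v (D.edgeAt y k) (D.edgeAt y (smooth (v y) k)) := by
  cases h : v y <;> fin_cases k
  · exact .rel _ _ (.zero_fst y h)
  · exact .symm _ _ (.rel _ _ (.zero_fst y h))
  · exact .rel _ _ (.zero_snd y h)
  · exact .symm _ _ (.rel _ _ (.zero_snd y h))
  · exact .rel _ _ (.one_fst y h)
  · exact .rel _ _ (.one_snd y h)
  · exact .symm _ _ (.rel _ _ (.one_snd y h))
  · exact .symm _ _ (.rel _ _ (.one_fst y h))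

/-- The universal property by which invariants are propagated along circles: choose `S` as the
relation of having equal invariant and check only single smoothed crossings. -/
lemma rel_le {S : Setoid D.Edge}
    (h : ∀ y k, S (D.edgeAt y k) (D.edgeAt y (smooth (v y) k))) : D.rel v ≤ S := by
  intro e f hef
  induction hef with
  | rel _ _ h' =>
    cases h' with
    | zero_fst y hy => simpa [smooth, hy] using h y 0
    | zero_snd y hy => simpa [smooth, hy] using h y 2
    | one_fst y hy => simpa [smooth, hy] using h y 0
    | one_snd y hy => simpa [smooth, hy] using h y 1
  | refl => exact S.refl _
  | symm _ _ _ h => exact S.symm h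
  | trans _ _ _ _ _ h h' => exact S.trans h h'

lemma off_smooth (v : D.Vertex) {x y : Fin D.n} (hy : y ≠ x) (k : Fin 4) :
    D.offSetoid v x (D.edgeAt y k) (D.edgeAt y (smooth (v y) k)) :=
  .rel _ _ ⟨y, k, hy, rfl, rfl⟩

lemma off_le {S : Setoid D.Edge}
    (h : ∀ y k, y ≠ x → S (D.edgeAt y k) (D.edgeAt y (smooth (v y) k))) : D.offSetoid v x ≤ S := by
  intro e f hef
  induction hef with
  | rel _ _ h' => obtain ⟨y, k, hy, rfl, rfl⟩ := h'; exact h y k hy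
  | refl => exact S.refl _
  | symm _ _ _ h => exact S.symm h
  | trans _ _ _ _ _ h h' => exact S.trans h h'

lemma off_le_rel : D.offSetoid v x ≤ D.rel v := off_le fun y k _ => rel_smooth v y k

lemma off_le_off (h : ∀ y, y ≠ x → v y = w y) : D.offSetoid v x ≤ D.offSetoid w x :=
  off_le fun y k hy => by rw [h y hy]; exact off_smooth w hy k

lemma off_congr (h : ∀ y, y ≠ x → v y = w y) : D.offSetoid v x = D.offSetoid w x :=
  le_antisymm (off_le_off h) (off_le_off fun y hy => (h y hy).symm)

/-- The end that the smoothing joins with an end, where the ends at `x` stay free. -/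
def joinedEnd (v : D.Vertex) (x : Fin D.n) : Equiv.Perm (Fin D.n × Fin 4) :=
  Function.Involutive.toPerm (fun d => if d.1 = x then d else (d.1, smooth (v d.1) d.2)) fun d => by
    by_cases h : d.1 = x <;> simp [h, smooth_smooth]

lemma joinedEnd_apply (v : D.Vertex) (x : Fin D.n) (d : Fin D.n × Fin 4) :
    joinedEnd v x d = if d.1 = x then d else (d.1, smooth (v d.1) d.2) := rfl

lemma joinedEnd_mul_self (v : D.Vertex) (x : Fin D.n) : joinedEnd v x * joinedEnd v x = 1 := by
  ext1 d
  rw [Equiv.Perm.mul_apply, joinedEnd_apply, joinedEnd_apply]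
  by_cases h : d.1 = x <;> simp [h, smooth_smooth]

lemma joinedEnd_eq_self_iff (v : D.Vertex) (x : Fin D.n) (d : Fin D.n × Fin 4) :
    joinedEnd v x d = d ↔ d.1 = x := by
  rw [joinedEnd_apply]
  split_ifs with h
  · simp [h]
  · simp only [h, iff_false]
    have : ∀ b k, smooth b k ≠ k := by decide
    exact fun h' => this _ _ (congrArg Prod.snd h')

/-- Removing the crossing `x` from a resolution leaves two arcs: every end at `x` is connected to
exactly one other end at `x`. -/
lemma exists_other_end (v : D.Vertex) (x : Fin D.n) (k : Fin 4) :
    ∃ j, j ≠ k ∧ D.offSetoid v x (D.edgeAt x k) (D.edgeAt x j) ∧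
      ∀ i, D.offSetoid v x (D.edgeAt x k) (D.edgeAt x i) → i = k ∨ i = j := by
  -- Walking along the tangle alternates between passing to the other end of an edge (`α`) and
  -- passing through a smoothed crossing (`β`). The fixed points of `β` are the four free ends at
  -- `x`.
  set α := D.otherEnd
  set β := joinedEnd v x
  have hα : α * α = 1 := D.otherEnd_mul_self
  have hβ : β * β = 1 := joinedEnd_mul_self v x
  have hk : β (x, k) = (x, k) := (joinedEnd_eq_self_iff v x _).2 rfl
  obtain ⟨⟨y, j⟩, hne, hj, hc, hu⟩ := exists_unique_other_fixed hα hβ D.otherEnd_ne hk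
  obtain rfl : y = x := (joinedEnd_eq_self_iff v x _).1 hj
  have hedge : ∀ d, D.edgeAt (α d).1 (α d).2 = D.edgeAt d.1 d.2 := fun d =>
    ((D.eq_or_eq_otherEnd_iff d (α d)).2 (Or.inr rfl)).symm
  refine ⟨j, fun h => hne (by rw [h]), ?_, fun i hi => ?_⟩
  · refine rel_of_sameCycle ((D.offSetoid v y).comap fun d => D.edgeAt d.1 d.2)
      (fun d => ?_) (fun d => ?_) hc
    · change D.offSetoid v y (D.edgeAt d.1 d.2) (D.edgeAt (α d).1 (α d).2)
      rw [hedge]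
    · change D.offSetoid v y (D.edgeAt d.1 d.2) (D.edgeAt (β d).1 (β d).2)
      rw [joinedEnd_apply]
      split_ifs with h
      · rfl
      · exact off_smooth v h _
  -- For uniqueness: whether an edge has an end in the orbit of `(y, k)` is invariant under the
  -- relation, so a connected end at `y` lies in this orbit and is one of its two fixed points.
  · have key : ∀ e f, D.offSetoid v y e f →
        ((∃ d, (α * β).SameCycle (y, k) d ∧ D.edgeAt d.1 d.2 = e) ↔
          ∃ d, (α * β).SameCycle (y, k) d ∧ D.edgeAt d.1 d.2 = f) := by
      have hend : ∀ d d', D.edgeAt d.1 d.2 = D.edgeAt d'.1 d'.2 → (α * β).SameCycle (y, k) d →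
          (α * β).SameCycle (y, k) d' := by
        intro d d' h hd
        obtain rfl | rfl := (D.eq_or_eq_otherEnd_iff d d').1 h
        · exact hd
        · exact sameCycle_apply_left hα hβ hk hd
      have hstep : ∀ z i, z ≠ y →
          (∃ d, (α * β).SameCycle (y, k) d ∧ D.edgeAt d.1 d.2 = D.edgeAt z i) →
          ∃ d, (α * β).SameCycle (y, k) d ∧ D.edgeAt d.1 d.2 = D.edgeAt z (smooth (v z) i) := by
        rintro z i hz ⟨d, hd, h⟩
        refine ⟨β (z, i), sameCycle_apply_right hα hβ hk (hend d (z, i) h hd), ?_⟩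
        rw [joinedEnd_apply, if_neg hz]
      refine off_le (S := Setoid.comap (fun e => ∃ d, (α * β).SameCycle (y, k) d ∧
        D.edgeAt d.1 d.2 = e) ⟨Iff, Iff.refl, Iff.symm, Iff.trans⟩) fun z i hz => ?_
      refine ⟨hstep z i hz, fun h => ?_⟩
      simpa [smooth_smooth] using hstep z _ hz h
    obtain ⟨d, hd, h⟩ := (key _ _ hi).1 ⟨(y, k), .refl _ _, rfl⟩
    have hfix : β (y, i) = (y, i) := (joinedEnd_eq_self_iff v y _).2 rfl
    have : (α * β).SameCycle (y, k) (y, i) := by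
      obtain h' | h' := (D.eq_or_eq_otherEnd_iff d (y, i)).1 h
      · rwa [h']
      · rw [h']; exact sameCycle_apply_left hα hβ hk hd
    simpa using hu _ this hfix

variable {D : LinkDiagram} {v w : D.Vertex} {x : Fin D.n}

/-! ### Potentials near a crossing -/

/-- A smoothing groups the four ends into two pairs, and each pair contributes twice the same value.
-/
lemma sum_indicator_eq_zero {S : Set D.Edge} {y : Fin D.n} (b : Bool)
    (h : ∀ k, D.edgeAt y k ∈ S → D.edgeAt y (smooth b k) ∈ S) :
    ∑ k, S.indicator (1 : D.Edge → ZMod 2) (D.edgeAt y k) = 0 := by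
  classical
  have h' : ∀ k, S.indicator (1 : D.Edge → ZMod 2) (D.edgeAt y (smooth b k)) =
      S.indicator (1 : D.Edge → ZMod 2) (D.edgeAt y k) := by
    intro k
    have : D.edgeAt y (smooth b k) ∈ S ↔ D.edgeAt y k ∈ S :=
      ⟨fun hk => by simpa [smooth_smooth] using h _ hk, h k⟩
    simp [Set.indicator_apply, this]
  generalize S.indicator (1 : D.Edge → ZMod 2) = g at *
  have h0 := h' 0
  have h1 := h' 1
  have h2 := h' 2
  rw [Fin.sum_univ_four]
  cases b
  · change g (D.edgeAt y 1) = _ at h0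
    change g (D.edgeAt y 3) = _ at h2
    rw [h0, h2, add_assoc, CharTwo.add_self_eq_zero, CharTwo.add_self_eq_zero, zero_add]
  · change g (D.edgeAt y 3) = _ at h0
    change g (D.edgeAt y 2) = _ at h1
    rw [h0, h1, add_assoc (g (D.edgeAt y 0)), CharTwo.add_self_eq_zero, add_zero,
      CharTwo.add_self_eq_zero]

variable {S : Set D.Edge}

lemma IsEven.pot_cornerAt_add (hS : D.IsEven S) (x : Fin D.n) (k : Fin 4) :
    D.pot S (D.cornerAt x k) + D.pot S (D.cornerAt x (k + 1)) =
      S.indicator 1 (D.edgeAt x (k + 1)) := by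
  rw [← coboundary_edgeAt, hS.isPotential_pot.2]

lemma IsEven.pot_cornerAt (hS : D.IsEven S) {x : Fin D.n} {k : Fin 4} (h : D.edgeAt x k ∉ S) :
    D.pot S (D.cornerAt x k) = D.pot S (D.left (D.edgeAt x k)) := by
  have := hS.pot_left_eq_right h
  unfold cornerAt
  split_ifs
  · rfl
  · exact this.symm

lemma IsEven.pot_cornerAt_pred (hS : D.IsEven S) {x : Fin D.n} {k : Fin 4}
    (h : D.edgeAt x (k + 1) ∉ S) :
    D.pot S (D.cornerAt x k) = D.pot S (D.left (D.edgeAt x (k + 1))) := by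
  have := hS.pot_left_eq_right h
  rw [cornerAt_succ]
  split_ifs
  · exact this.symm
  · rfl

/-- Ends joined by a smoothing are neighbours and share a corner. Off `S`, both sides of each edge
have the potential of this corner. -/
lemma IsEven.pot_left_smooth (hS : D.IsEven S) {x : Fin D.n} (b : Bool) {k : Fin 4}
    (h : D.edgeAt x k ∉ S) (h' : D.edgeAt x (smooth b k) ∉ S) :
    D.pot S (D.left (D.edgeAt x k)) = D.pot S (D.left (D.edgeAt x (smooth b k))) := by
  have key : ∀ i, D.edgeAt x i ∉ S → D.edgeAt x (i + 1) ∉ S →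
      D.pot S (D.left (D.edgeAt x i)) = D.pot S (D.left (D.edgeAt x (i + 1))) :=
    fun i h h' => (hS.pot_cornerAt h).symm.trans (hS.pot_cornerAt_pred h')
  have hk : smooth b k = k + 1 ∨ k = smooth b k + 1 := by
    clear * -; revert b k; decide
  obtain hk | hk := hk
  · rw [hk] at h' ⊢
    exact key k h h'
  · generalize smooth b k = i at *
    subst hk
    exact (key i h' h).symm

/-- An equivalence relation on edges that is used to propagate potentials along circles. -/
def sideSetoid (S : Set D.Edge) : Setoid D.Edge where
  r e f := (e ∈ S ↔ f ∈ S) ∧ (e ∉ S → D.pot S (D.left e) = D.pot S (D.left f))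
  iseqv :=
    ⟨fun _ => ⟨Iff.rfl, fun _ => rfl⟩,
      fun h => ⟨h.1.symm, fun hf => (h.2 fun he => hf (h.1.1 he)).symm⟩,
      fun h h' => ⟨h.1.trans h'.1, fun he => (h.2 he).trans (h'.2 fun hf => he (h.1.2 hf))⟩⟩

lemma IsEven.sideSetoid_smooth (hS : D.IsEven S) {y : Fin D.n} {b : Bool}
    (h : ∀ k, D.edgeAt y k ∈ S → D.edgeAt y (smooth b k) ∈ S) (k : Fin 4) :
    sideSetoid S (D.edgeAt y k) (D.edgeAt y (smooth b k)) := by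
  have hk : D.edgeAt y k ∈ S ↔ D.edgeAt y (smooth b k) ∈ S :=
    ⟨h k, fun hk => by simpa [smooth_smooth] using h _ hk⟩
  exact ⟨hk, fun he => hS.pot_left_smooth b he fun hf => he (hk.2 hf)⟩

/-- A union of circles of a resolution. -/
lemma isEven_of_rel (h : ∀ e f, D.rel v e f → e ∈ S → f ∈ S) : D.IsEven S :=
  fun y => sum_indicator_eq_zero (v y) fun k => h _ _ (rel_smooth v y k)

/-- A circle disjoint from `S` never crosses it, so the potential of `S` is constant along the
circle. -/
lemma rel_le_sideSetoid (h : ∀ e f, D.rel v e f → e ∈ S → f ∈ S) : D.rel v ≤ sideSetoid S :=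
  rel_le fun y k => (isEven_of_rel h).sideSetoid_smooth (fun i => h _ _ (rel_smooth v y i)) k

/-! ### The two ways of connecting the ends at a crossing -/

/-- An arc has exactly two ends at `x`, and the smoothing pairs its ends at every other crossing. -/
lemma isEven_off {a j : Fin 4} (haj : a ≠ j)
    (ha : D.offSetoid v x (D.edgeAt x a) (D.edgeAt x j))
    (h : ∀ i, D.offSetoid v x (D.edgeAt x a) (D.edgeAt x i) → i = a ∨ i = j) :
    D.IsEven {e | D.offSetoid v x (D.edgeAt x a) e} := by
  classical
  intro y
  by_cases hy : y = x
  · subst hy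
    have hi : ∀ i, D.edgeAt y i ∈ {e | D.offSetoid v y (D.edgeAt y a) e} ↔ i = a ∨ i = j := by
      refine fun i => ⟨h i, ?_⟩
      rintro (rfl | rfl)
      · exact (D.offSetoid v y).refl _
      · exact ha
    simp only [Set.indicator_apply, hi, Pi.one_apply]
    revert haj; clear ha h hi; revert a j; decide
  · exact sum_indicator_eq_zero (v y) fun k hk =>
      (D.offSetoid v x).trans hk (off_smooth v hy k)

/-- Opposite ends at a crossing are not connected outside of it. -/
lemma not_off_zero_two (v : D.Vertex) (x : Fin D.n) :
    ¬ D.offSetoid v x (D.edgeAt x 0) (D.edgeAt x 2) := by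
  intro h02
  set P := D.offSetoid v x
  obtain ⟨j, hj, hPj, hu⟩ := exists_other_end v x 0
  obtain rfl : j = 2 := ((hu 2 h02).resolve_left (by decide)).symm
  obtain ⟨i, hi, hPi, hu'⟩ := exists_other_end v x 1
  have h1 : ¬ P (D.edgeAt x 0) (D.edgeAt x 1) := fun h => by simpa using hu 1 h
  have hi0 : i ≠ 0 := by rintro rfl; exact h1 (P.symm hPi)
  have hi2 : i ≠ 2 := by rintro rfl; exact h1 (P.trans h02 (P.symm hPi))
  obtain rfl : i = 3 := by revert hi hi0 hi2; clear hPi hu'; revert i; decide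
  -- The arc from end 1 to end 3 closes up to an even set `S` that meets the arc from 0 to 2 only at
  -- `x`. Its potential is constant along that arc, yet the corners 0 and 1, which touch the ends 0
  -- and 2, are separated by the end 1.
  set S : Set D.Edge := {e | P (D.edgeAt x 1) e}
  have hS : D.IsEven S := isEven_off hi.symm hPi hu'
  have hle : P ≤ sideSetoid S := off_le fun y k hy =>
    hS.sideSetoid_smooth (fun i hi => P.trans hi (off_smooth v hy i)) k
  have h0S : D.edgeAt x 0 ∉ S := fun h => h1 (P.symm h)
  have h2S : D.edgeAt x 2 ∉ S := fun h => h1 (P.trans h02 (P.symm h))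
  have e1 := (hle h02).2 h0S
  have e2 := hS.pot_cornerAt h0S
  have e3 := hS.pot_cornerAt_pred (k := 1) h2S
  have e4 := hS.pot_cornerAt_add x 0
  have h1S : D.edgeAt x (0 + 1) ∈ S := P.refl _
  rw [Set.indicator_of_mem h1S, e2, e1] at e4
  change _ + D.pot S (D.cornerAt x 1) = 1 at e4
  rw [e3] at e4
  exact absurd ((CharTwo.add_self_eq_zero _).symm.trans e4) (by decide)

/-- The resolution `w` arises from `v` by merging the two circles of `v` at the crossing `x`. -/
def Merges (v w : D.Vertex) (x : Fin D.n) : Prop :=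
  ¬ D.rel v (D.edgeAt x 0) (D.edgeAt x 2) ∧ ∀ e f, D.rel w e f ↔ D.rel v e f ∨
    ((D.rel v (D.edgeAt x 0) e ∨ D.rel v (D.edgeAt x 2) e) ∧
      (D.rel v (D.edgeAt x 0) f ∨ D.rel v (D.edgeAt x 2) f))

/-- The relation obtained by merging the classes of `a` and `b`. -/
def mergedSetoid {α : Type*} (r : Setoid α) (a b : α) : Setoid α where
  r e f := r e f ∨ ((r a e ∨ r b e) ∧ (r a f ∨ r b f))
  iseqv := by
    refine ⟨fun e => Or.inl (r.refl e), fun h => ?_, fun {e f g} h h' => ?_⟩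
    · exact h.imp r.symm And.symm
    · obtain h | ⟨he, hf⟩ := h
      · obtain h' | ⟨hf', hg⟩ := h'
        · exact Or.inl (r.trans h h')
        · exact Or.inr ⟨hf'.imp (fun q => r.trans q (r.symm h)) (fun q => r.trans q (r.symm h)), hg⟩
      · obtain h' | ⟨_, hg⟩ := h'
        · exact Or.inr ⟨he, hf.imp (fun q => r.trans q h') (fun q => r.trans q h')⟩
        · exact Or.inr ⟨he, hg⟩

/-- If `v` smooths `x` just as the ends are connected outside, it closes each of the two arcs
separately and adds no relation. The opposite smoothing then joins the two arcs. -/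
lemma merges_of_off (hvw : ∀ y, y ≠ x → v y = w y) (hx : w x = !v x)
    (h : D.offSetoid v x (D.edgeAt x 0) (D.edgeAt x (smooth (v x) 0))) : Merges v w x := by
  have hoff := off_congr hvw
  set P := D.offSetoid v x
  obtain ⟨j, hj, hPj, hu⟩ := exists_other_end v x 0
  have hne : ∀ b, smooth b 0 ≠ 0 ∧ smooth b 0 ≠ 2 := by decide
  obtain rfl : smooth (v x) 0 = j := (hu _ h).resolve_left (hne _).1
  have h02 : ¬ P (D.edgeAt x 0) (D.edgeAt x 2) := not_off_zero_two v x
  obtain ⟨i, hi, hPi, hu'⟩ := exists_other_end v x 2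
  have hi0 : i ≠ 0 := by rintro rfl; exact h02 (P.symm hPi)
  have hij : i ≠ smooth (v x) 0 := by rintro rfl; exact h02 (P.trans hPj (P.symm hPi))
  have hi' : i = smooth (v x) 2 := by
    revert hi hi0 hij; generalize v x = b; clear * -; revert i b; decide
  subst hi'
  have hrel : D.rel v = P := by
    refine le_antisymm (rel_le fun y k => ?_) off_le_rel
    by_cases hy : y = x
    · subst hy
      obtain rfl | rfl | rfl | rfl : k = 0 ∨ k = smooth (v y) 0 ∨ k = 2 ∨ k = smooth (v y) 2 := by
        generalize v y = b; clear * -; revert b k; decide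
      · exact hPj
      · rw [smooth_smooth]; exact P.symm hPj
      · exact hPi
      · rw [smooth_smooth]; exact P.symm hPi
    · exact off_smooth v hy k
  refine ⟨by rwa [hrel], fun e f => ⟨fun hef => ?_, ?_⟩⟩
  · refine rel_le (S := mergedSetoid (D.rel v) (D.edgeAt x 0) (D.edgeAt x 2)) (fun y k => ?_) hef
    by_cases hy : y = x
    · subst hy
      have : ∀ k, D.rel v (D.edgeAt y 0) (D.edgeAt y k) ∨ D.rel v (D.edgeAt y 2) (D.edgeAt y k) := by
        intro k
        obtain rfl | rfl | rfl | rfl : k = 0 ∨ k = smooth (v y) 0 ∨ k = 2 ∨ k = smooth (v y) 2 := by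
          generalize v y = b; clear * -; revert b k; decide
        · exact Or.inl ((D.rel v).refl _)
        · exact Or.inl (rel_smooth v y 0)
        · exact Or.inr ((D.rel v).refl _)
        · exact Or.inr (rel_smooth v y 2)
      exact Or.inr ⟨this _, this _⟩
    · rw [← hvw y hy]
      exact Or.inl (rel_smooth v y k)
  · have hle : D.rel v ≤ D.rel w := by
      rw [hrel, hoff]
      exact off_le_rel
    have h1 : D.rel w (D.edgeAt x 0) (D.edgeAt x 2) := by
      have h2 := rel_smooth w x 0
      refine (D.rel w).trans h2 ((D.rel w).symm (hle ?_))
      have : smooth (w x) 0 = smooth (v x) 2 := by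
        rw [hx]; generalize v x = b; clear * -; revert b; decide
      rw [this]
      exact rel_smooth v x 2
    have h3 : ∀ e, D.rel v (D.edgeAt x 0) e ∨ D.rel v (D.edgeAt x 2) e →
        D.rel w (D.edgeAt x 0) e := by
      rintro e (he | he)
      · exact hle he
      · exact (D.rel w).trans h1 (hle he)
    rintro (h | ⟨he, hf⟩)
    · exact hle h
    · exact (D.rel w).trans ((D.rel w).symm (h3 e he)) (h3 f hf)

/-- A saddle is either a merge or a split. -/
lemma merges_or_merges (hvw : ∀ y, y ≠ x → v y = w y) (hx : w x = !v x) :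
    Merges v w x ∨ Merges w v x := by
  obtain ⟨j, hj, hPj, -⟩ := exists_other_end v x 0
  -- The outside partner of end 0 is 1 or 3, hence its partner under the smoothing of `v` or of `w`.
  -- The matching resolution is the one with two circles.
  have hj2 : j ≠ 2 := by rintro rfl; exact not_off_zero_two v x hPj
  have hj' : j = smooth (v x) 0 ∨ j = smooth (w x) 0 := by
    rw [hx]; generalize v x = b; revert hj hj2; clear * -; revert j b; decide
  obtain rfl | rfl := hj'
  · exact Or.inl (merges_of_off hvw hx hPj)
  · refine Or.inr (merges_of_off (fun y hy => (hvw y hy).symm) (by simp [hx]) ?_)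
    rwa [off_congr fun y hy => (hvw y hy).symm]

variable {D : LinkDiagram} {v w : D.Vertex} {x : Fin D.n}

/-! ### Circles and their insides -/

instance (v : D.Vertex) : Finite (D.Circle v) := Subtype.finite

instance (v : D.Vertex) : Fintype (D.Circle v) := Fintype.ofFinite _

lemma mem_circleThrough {e f : D.Edge} : f ∈ (D.circleThrough v e).1 ↔ D.rel v f e := Iff.rfl

lemma self_mem_circleThrough (e : D.Edge) : e ∈ (D.circleThrough v e).1 := (D.rel v).refl e

lemma circleThrough_eq_iff {e f : D.Edge} :
    D.circleThrough v e = D.circleThrough v f ↔ D.rel v e f := by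
  refine ⟨fun h => ?_, fun h => Subtype.ext (Set.ext fun g => ?_)⟩
  · rw [← mem_circleThrough, ← h]; exact self_mem_circleThrough e
  · exact ⟨fun hg => (D.rel v).trans hg h, fun hg => (D.rel v).trans hg ((D.rel v).symm h)⟩

lemma exists_eq_circleThrough (c : D.Circle v) : ∃ e, c = D.circleThrough v e := by
  obtain ⟨_, e, rfl⟩ := c
  exact ⟨e, rfl⟩

lemma mem_iff_eq_circleThrough {c : D.Circle v} {e : D.Edge} :
    e ∈ c.1 ↔ c = D.circleThrough v e := by
  obtain ⟨f, rfl⟩ := exists_eq_circleThrough c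
  rw [mem_circleThrough, circleThrough_eq_iff]
  exact ⟨(D.rel v).symm, (D.rel v).symm⟩

lemma circle_closed (c : D.Circle v) (e f : D.Edge) (h : D.rel v e f) (he : e ∈ c.1) :
    f ∈ c.1 := by
  rw [mem_iff_eq_circleThrough] at he ⊢
  rw [he, circleThrough_eq_iff]
  exact h

lemma isEven_circle (c : D.Circle v) : D.IsEven c.1 := isEven_of_rel (circle_closed c)

lemma edgeAt_mem_smooth_iff (c : D.Circle v) (y : Fin D.n) (k : Fin 4) :
    D.edgeAt y k ∈ c.1 ↔ D.edgeAt y (smooth (v y) k) ∈ c.1 :=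
  ⟨circle_closed c _ _ (rel_smooth v y k), circle_closed c _ _ ((D.rel v).symm (rel_smooth v y k))⟩

/-- Moving between the two corners of a channel crosses two ends joined by the smoothing. Either
both or neither lie on the circle, so the jumps cancel. -/
lemma pot_eq_of_adjacent {c : D.Circle v} {r s : Fin D.m} (h : D.Adjacent v c r s) :
    D.pot c.1 r = D.pot c.1 s := by
  have hc := isEven_circle c
  have key : ∀ (y : Fin D.n) (k : Fin 4),
      (D.edgeAt y (k + 1) ∈ c.1 ↔ D.edgeAt y (k + 1 + 1) ∈ c.1) →
      D.pot c.1 (D.cornerAt y k) = D.pot c.1 (D.cornerAt y (k + 1 + 1)) := by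
    classical
    intro y k hk
    have h1 := hc.pot_cornerAt_add y k
    have h2 := hc.pot_cornerAt_add y (k + 1)
    rw [← CharTwo.add_eq_zero]
    have h3 : D.pot c.1 (D.cornerAt y k) + D.pot c.1 (D.cornerAt y (k + 1)) =
        D.pot c.1 (D.cornerAt y (k + 1)) + D.pot c.1 (D.cornerAt y (k + 1 + 1)) := by
      rw [h1, h2]
      simp only [Set.indicator_apply, hk, Pi.one_apply]
    rw [add_comm (D.pot c.1 (D.cornerAt y k))] at h3
    rw [add_left_cancel h3]
    exact CharTwo.add_self_eq_zero _
  cases h with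
  | across e h => exact hc.pot_left_eq_right h
  | channel_zero y h =>
    refine key y 1 ?_
    have := edgeAt_mem_smooth_iff c y 2
    rwa [h] at this
  | channel_one y h =>
    refine key y 0 ?_
    have := edgeAt_mem_smooth_iff c y 1
    rwa [h] at this

variable (D) in
/-- The unordered pair of the two sides of an edge, up to an equivalence relation on regions. -/
def sides (T : Setoid (Fin D.m)) (e : D.Edge) : Sym2 (Quotient T) :=
  s(⟦D.left e⟧, ⟦D.right e⟧)

lemma sides_edgeAt_succ (T : Setoid (Fin D.m)) (y : Fin D.n) (k : Fin 4) :
    D.sides T (D.edgeAt y (k + 1)) = s(⟦D.cornerAt y k⟧, ⟦D.cornerAt y (k + 1)⟧) := by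
  rw [cornerAt_succ, cornerAt, sides, edgeAt]
  split_ifs
  · exact Sym2.eq_swap
  · rfl

lemma pot_eq_of_eqvGen {c : D.Circle v} {r s : Fin D.m}
    (h : Relation.EqvGen (D.Adjacent v c) r s) : D.pot c.1 r = D.pot c.1 s := by
  induction h with
  | rel _ _ h => exact pot_eq_of_adjacent h
  | refl => rfl
  | symm _ _ _ h => exact h.symm
  | trans _ _ _ _ _ h h' => exact h.trans h'

/-- Two regions can be connected in the complement of a circle if and only if the potential of the
circle has the same value on them. -/
lemma eqvGen_adjacent_iff (c : D.Circle v) (r s : Fin D.m) :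
    Relation.EqvGen (D.Adjacent v c) r s ↔ D.pot c.1 r = D.pot c.1 s := by
  refine ⟨pot_eq_of_eqvGen, ?_⟩
  set T : Setoid (Fin D.m) := Relation.EqvGen.setoid (D.Adjacent v c)
  -- The channel at a crossing identifies the two outer corners of the smoothed strand, so the pair
  -- of components beside a circle does not change along it.
  have hsmooth : ∀ y k, D.sides T (D.edgeAt y k) = D.sides T (D.edgeAt y (smooth (v y) k)) := by
    intro y k
    have e0 : D.sides T (D.edgeAt y 0) = s(⟦D.cornerAt y 3⟧, ⟦D.cornerAt y 0⟧) :=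
      sides_edgeAt_succ T y 3
    have e1 : D.sides T (D.edgeAt y 1) = s(⟦D.cornerAt y 0⟧, ⟦D.cornerAt y 1⟧) :=
      sides_edgeAt_succ T y 0
    have e2 : D.sides T (D.edgeAt y 2) = s(⟦D.cornerAt y 1⟧, ⟦D.cornerAt y 2⟧) :=
      sides_edgeAt_succ T y 1
    have e3 : D.sides T (D.edgeAt y 3) = s(⟦D.cornerAt y 2⟧, ⟦D.cornerAt y 3⟧) :=
      sides_edgeAt_succ T y 2
    cases h : v y
    · have hT : (⟦D.cornerAt y 1⟧ : Quotient T) = ⟦D.cornerAt y 3⟧ :=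
        Quotient.sound (.rel _ _ (.channel_zero y h))
      have h01 : D.sides T (D.edgeAt y 0) = D.sides T (D.edgeAt y 1) := by
        rw [e0, e1, hT, Sym2.eq_swap]
      have h23 : D.sides T (D.edgeAt y 2) = D.sides T (D.edgeAt y 3) := by
        rw [e2, e3, hT, Sym2.eq_swap]
      fin_cases k
      exacts [h01, h01.symm, h23, h23.symm]
    · have hT : (⟦D.cornerAt y 0⟧ : Quotient T) = ⟦D.cornerAt y 2⟧ :=
        Quotient.sound (.rel _ _ (.channel_one y h))
      have h03 : D.sides T (D.edgeAt y 0) = D.sides T (D.edgeAt y 3) := by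
        rw [e0, e3, hT, Sym2.eq_swap]
      have h12 : D.sides T (D.edgeAt y 1) = D.sides T (D.edgeAt y 2) := by
        rw [e1, e2, hT, Sym2.eq_swap]
      fin_cases k
      exacts [h03, h12, h12.symm, h03.symm]
  have hrel : ∀ e f, D.rel v e f → D.sides T e = D.sides T f := fun e f h =>
    rel_le (S := Setoid.ker (D.sides T)) hsmooth h
  obtain ⟨e, rfl⟩ := exists_eq_circleThrough c
  -- Connectedness of the surface: the complement has at most the two components on the sides of
  -- `e`. The potential then tells these two apart.
  have hmem : ∀ r, (⟦r⟧ : Quotient T) ∈ D.sides T e := by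
    have hconn : ∀ r s, (⟦r⟧ : Quotient T) ∈ D.sides T e ↔ (⟦s⟧ : Quotient T) ∈ D.sides T e := by
      intro r s
      induction D.connected r s with
      | rel _ _ h =>
        obtain ⟨f, rfl, rfl⟩ := h
        by_cases hf : f ∈ (D.circleThrough v e).1
        · rw [← hrel _ _ hf]
          simp [sides]
        · rw [show (⟦D.left f⟧ : Quotient T) = ⟦D.right f⟧ from
            Quotient.sound (.rel _ _ (.across f hf))]
      | refl => rfl
      | symm _ _ _ h => exact h.symm
      | trans _ _ _ _ _ h h' => exact h.trans h'
    exact fun r => (hconn (D.left e) r).1 (by simp [sides])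
  have hpot : ∀ r s, (⟦r⟧ : Quotient T) = ⟦s⟧ →
      D.pot (D.circleThrough v e).1 r = D.pot (D.circleThrough v e).1 s := by
    intro r s h
    exact pot_eq_of_eqvGen (Quotient.exact h)
  intro h
  have hne : D.pot (D.circleThrough v e).1 (D.left e) ≠ D.pot (D.circleThrough v e).1 (D.right e) :=
    fun h => by
      have := (isEven_circle (D.circleThrough v e)).pot_left_right_of_mem (self_mem_circleThrough e)
      rw [h, CharTwo.add_self_eq_zero] at this
      exact absurd this (by decide)
  refine Quotient.exact (s := T) ?_
  have hr := hmem r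
  have hs := hmem s
  simp only [sides, Sym2.mem_iff] at hr hs
  obtain hr | hr := hr <;> obtain hs | hs := hs
  · exact hr.trans hs.symm
  · exact absurd ((hpot _ _ hr).symm.trans (h.trans (hpot _ _ hs))) hne
  · exact absurd ((hpot _ _ hs).symm.trans (h.symm.trans (hpot _ _ hr))) hne
  · exact hr.trans hs.symm

lemma pot_left_eq_of_mem {c c' : D.Circle v} {e f : D.Edge} (hne : c ≠ c') (he : e ∈ c.1)
    (hf : f ∈ c.1) : D.pot c'.1 (D.left e) = D.pot c'.1 (D.left f) := by
  have hef : D.rel v e f := by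
    rw [← circleThrough_eq_iff, ← mem_iff_eq_circleThrough.1 he, ← mem_iff_eq_circleThrough.1 hf]
  refine (rel_le_sideSetoid (circle_closed c') hef).2 fun h => hne ?_
  rw [mem_iff_eq_circleThrough.1 he, mem_iff_eq_circleThrough.1 h]

/-- One edge of `c` suffices because the potential of another circle is constant along `c`. -/
lemma inside_iff {c c' : D.Circle v} {e : D.Edge} (he : e ∈ c.1) :
    D.Inside v c c' ↔ c ≠ c' ∧ D.pot c'.1 (D.left e) = 1 := by
  have h01 : ∀ a : ZMod 2, a ≠ 0 ↔ a = 1 := by decide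
  refine and_congr_right fun hne => ?_
  simp only [eqvGen_adjacent_iff, (isEven_circle c').pot_outer, h01]
  exact ⟨fun h => h e he, fun h f hf => (pot_left_eq_of_mem hne hf he).trans h⟩

/-- If each circle were inside the other, the product and the sum of their potentials would have the
same coboundary and agree at the unbounded region. But ab = a + b in `ZMod 2` forces a = 0, against
the jump across `c`. -/
lemma Inside.not_inside {c c' : D.Circle v} (h : D.Inside v c c') : ¬ D.Inside v c' c := by
  intro h'
  have hc := isEven_circle c
  have hc' := isEven_circle c'
  have hdisj : ∀ e, e ∈ c.1 → e ∉ c'.1 := fun e he he' =>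
    h.1 ((mem_iff_eq_circleThrough.1 he).trans (mem_iff_eq_circleThrough.1 he').symm)
  have heq : D.pot c.1 * D.pot c'.1 = D.pot c.1 + D.pot c'.1 := by
    refine eq_of_coboundary_eq (by simp [hc.pot_outer, hc'.pot_outer]) (funext fun e => ?_)
    simp only [coboundary_apply, Pi.mul_apply, Pi.add_apply]
    by_cases he : e ∈ c.1
    · have h1 := ((inside_iff he).1 h).2
      rw [← hc'.pot_left_eq_right (hdisj e he), h1, mul_one, mul_one, add_add_add_comm,
        CharTwo.add_self_eq_zero, add_zero]
    by_cases he' : e ∈ c'.1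
    · have h1 := ((inside_iff he').1 h').2
      rw [← hc.pot_left_eq_right he, h1, one_mul, one_mul, add_add_add_comm,
        CharTwo.add_self_eq_zero, zero_add]
    · rw [hc.pot_left_eq_right he, hc'.pot_left_eq_right he', CharTwo.add_self_eq_zero,
        CharTwo.add_self_eq_zero]
  have h0 : ∀ r, D.pot c.1 r = 0 := by
    intro r
    have := congrFun heq r
    have key : ∀ a b : ZMod 2, a * b = a + b → a = 0 := by decide
    exact key _ _ this
  obtain ⟨e, rfl⟩ := exists_eq_circleThrough c
  have := hc.pot_left_right_of_mem (self_mem_circleThrough e)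
  rw [h0, h0] at this
  exact absurd this (by decide)

/-! ### Nesting numbers modulo two -/

lemma isEven_univ : D.IsEven Set.univ :=
  isEven_of_rel (v := fun _ => false) fun _ _ _ _ => Set.mem_univ _

/-- The circles partition the edges. The point is that the right side does not involve `v`. -/
lemma sum_pot (v : D.Vertex) : ∑ c : D.Circle v, D.pot c.1 = D.pot Set.univ := by
  classical
  refine eq_of_coboundary_eq ?_ ?_
  · rw [Finset.sum_apply, isEven_univ.pot_outer]
    exact Finset.sum_eq_zero fun c _ => (isEven_circle c).pot_outer
  · rw [map_sum, isEven_univ.isPotential_pot.2]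
    ext e
    simp only [(isEven_circle _).isPotential_pot.2, Finset.sum_apply, Set.indicator_apply,
      mem_iff_eq_circleThrough]
    simp

/-- The nesting number is the sum of the potentials of all circles other than `c`; the second
summand removes the term of `c` itself. -/
lemma natCast_nes {c : D.Circle v} {e : D.Edge} (he : e ∈ c.1) :
    (D.nes v c : ZMod 2) = D.pot Set.univ (D.left e) + D.pot c.1 (D.left e) := by
  classical
  have h01 : ∀ a : ZMod 2, (if a = 1 then (1 : ZMod 2) else 0) = a := by decide
  rw [nes, Nat.card_eq_fintype_card, Fintype.card_subtype, ← sum_pot v, Finset.sum_apply,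
    Finset.card_filter]
  push_cast
  rw [← Finset.add_sum_erase _ _ (Finset.mem_univ c),
    ← Finset.add_sum_erase (a := c) _ (fun c : D.Circle v => D.pot c.1 (D.left e))
      (Finset.mem_univ c), add_comm _ (D.pot c.1 (D.left e)), ← add_assoc,
    CharTwo.add_self_eq_zero, if_neg (fun h => h.1 rfl)]
  refine congrArg _ (Finset.sum_congr rfl fun c' hc' => ?_)
  simp only [inside_iff he, ne_eq, (Finset.ne_of_mem_erase hc').symm, not_false_eq_true, true_and,
    h01]

lemma natCast_nes_right {c : D.Circle v} {e : D.Edge} (he : e ∈ c.1) :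
    (D.nes v c : ZMod 2) = D.pot Set.univ (D.right e) + D.pot c.1 (D.right e) := by
  have h1 := isEven_univ.pot_left_right_of_mem (Set.mem_univ e)
  have h2 := (isEven_circle c).pot_left_right_of_mem he
  rw [natCast_nes he]
  have key : ∀ a b c d : ZMod 2, a + b = 1 → c + d = 1 → a + c = b + d := by decide
  exact key _ _ _ _ h1 h2

lemma natCast_nes_cornerAt {c : D.Circle v} {x : Fin D.n} {k : Fin 4} (h : D.edgeAt x k ∈ c.1) :
    (D.nes v c : ZMod 2) = D.pot Set.univ (D.cornerAt x k) + D.pot c.1 (D.cornerAt x k) := by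
  unfold cornerAt
  split_ifs
  exacts [natCast_nes h, natCast_nes_right h]

lemma natCast_nes_cornerAt_pred {c : D.Circle v} {x : Fin D.n} {k : Fin 4}
    (h : D.edgeAt x (k + 1) ∈ c.1) :
    (D.nes v c : ZMod 2) = D.pot Set.univ (D.cornerAt x k) + D.pot c.1 (D.cornerAt x k) := by
  rw [cornerAt_succ]
  split_ifs
  exacts [natCast_nes_right h, natCast_nes h]

/-! ### Circles and nesting parity across a merge. -/

namespace Merges

variable {b s : D.Vertex}

lemma arcFst_ne_arcSnd (h : Merges b s x) : D.arcFst b x ≠ D.arcSnd b x :=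
  fun h' => h.1 (circleThrough_eq_iff.1 h')

lemma rel_of_rel (h : Merges b s x) {e f : D.Edge} (hef : D.rel b e f) : D.rel s e f :=
  (h.2 e f).2 (Or.inl hef)

lemma rel_zero_two (h : Merges b s x) : D.rel s (D.edgeAt x 0) (D.edgeAt x 2) :=
  (h.2 _ _).2 (Or.inr ⟨Or.inl ((D.rel b).refl _), Or.inr ((D.rel b).refl _)⟩)

lemma arcFst_eq_arcSnd (h : Merges b s x) : D.arcFst s x = D.arcSnd s x :=
  circleThrough_eq_iff.2 h.rel_zero_two

lemma mem_arcFst_iff (h : Merges b s x) (e : D.Edge) :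
    e ∈ (D.arcFst s x).1 ↔ e ∈ (D.arcFst b x).1 ∨ e ∈ (D.arcSnd b x).1 := by
  change D.rel s _ _ ↔ D.rel b _ _ ∨ D.rel b _ _
  rw [h.2]
  constructor
  · rintro (h1 | ⟨h1 | h1, -⟩)
    exacts [Or.inl h1, Or.inl ((D.rel b).symm h1), Or.inr ((D.rel b).symm h1)]
  · exact fun h1 => Or.inr ⟨h1.imp (D.rel b).symm (D.rel b).symm, Or.inl ((D.rel b).refl _)⟩

lemma circleThrough_eq (h : Merges b s x) {e : D.Edge} (h0 : e ∉ (D.arcFst b x).1)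
    (h2 : e ∉ (D.arcSnd b x).1) :
    (D.circleThrough s e).1 = (D.circleThrough b e).1 := by
  ext f
  rw [mem_circleThrough, mem_circleThrough, h.2, or_iff_left_iff_imp]
  rintro ⟨-, h' | h'⟩
  exacts [(h0 ((D.rel b).symm h')).elim, (h2 ((D.rel b).symm h')).elim]

lemma pot_arcFst (h : Merges b s x) :
    D.pot (D.arcFst s x).1 = D.pot (D.arcFst b x).1 + D.pot (D.arcSnd b x).1 := by
  classical
  refine IsPotential.pot_eq ⟨?_, ?_⟩
  · simp [(isEven_circle _).pot_outer]
  · rw [map_add, (isEven_circle _).isPotential_pot.2, (isEven_circle _).isPotential_pot.2]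
    ext e
    have hdisj : ¬ (e ∈ (D.arcFst b x).1 ∧ e ∈ (D.arcSnd b x).1) := fun ⟨h0, h2⟩ =>
      h.arcFst_ne_arcSnd
        ((mem_iff_eq_circleThrough.1 h0).trans (mem_iff_eq_circleThrough.1 h2).symm)
    simp only [Pi.add_apply, Set.indicator_apply, h.mem_arcFst_iff, Pi.one_apply]
    by_cases h0 : e ∈ (D.arcFst b x).1 <;> by_cases h2 : e ∈ (D.arcSnd b x).1 <;> simp_all

/-- This corner belongs to the channel between the two arcs, so its region touches both circles. -/
lemma exists_corner (b : D.Vertex) (x : Fin D.n) : ∃ k : Fin 4, D.edgeAt x k ∈ (D.arcFst b x).1 ∧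
    D.edgeAt x (k + 1) ∈ (D.arcSnd b x).1 := by
  cases hb : b x
  · refine ⟨1, ?_, self_mem_circleThrough _⟩
    have := rel_smooth b x 1
    rwa [hb] at this
  · refine ⟨0, self_mem_circleThrough _, ?_⟩
    have := rel_smooth b x 1
    rwa [hb] at this

lemma natCast_nes_eq (h : Merges b s x) {e : D.Edge} (h0 : e ∉ (D.arcFst b x).1)
    (h2 : e ∉ (D.arcSnd b x).1) :
    (D.nes s (D.circleThrough s e) : ZMod 2) = D.nes b (D.circleThrough b e) := by
  rw [natCast_nes (self_mem_circleThrough e), natCast_nes (self_mem_circleThrough e),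
    h.circleThrough_eq h0 h2]

/-- Of the two circles at a crossing the outer one has the same nesting number modulo `2` as the
circle obtained by merging them, and so has the inner one if and only if they are not nested. -/
lemma natCast_nes_innerOuter (h : Merges b s x) :
    (D.nes b (D.innerOuter b x).1 : ZMod 2) = D.nes s (D.arcFst s x) + D.nestedAt b x ∧
      (D.nes b (D.innerOuter b x).2 : ZMod 2) = D.nes s (D.arcFst s x) := by
  obtain ⟨k, hk, hk'⟩ := exists_corner b x
  have hne := h.arcFst_ne_arcSnd
  have hks : D.edgeAt x k ∈ (D.arcFst s x).1 := (h.mem_arcFst_iff _).2 (Or.inl hk)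
  have hkn : D.edgeAt x k ∉ (D.arcSnd b x).1 := fun h2 => hne
    ((mem_iff_eq_circleThrough.1 hk).trans (mem_iff_eq_circleThrough.1 h2).symm)
  have hkn' : D.edgeAt x (k + 1) ∉ (D.arcFst b x).1 := fun h2 => hne
    ((mem_iff_eq_circleThrough.1 h2).trans (mem_iff_eq_circleThrough.1 hk').symm)
  have e0 := natCast_nes_cornerAt hk
  have e2 := natCast_nes_cornerAt_pred hk'
  have es := natCast_nes_cornerAt hks
  have i0 := inside_iff (c' := D.arcSnd b x) hk
  have i2 := inside_iff (c' := D.arcFst b x) hk'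
  rw [← (isEven_circle _).pot_cornerAt hkn] at i0
  rw [← (isEven_circle _).pot_cornerAt_pred hkn'] at i2
  simp only [ne_eq, hne, hne.symm, not_false_eq_true, true_and] at i0 i2
  have hnot := fun h => Inside.not_inside (c := D.arcFst b x) (c' := D.arcSnd b x) h
  rw [h.pot_arcFst] at es
  unfold nestedAt innerOuter
  rw [i0, i2] at *
  simp only [Pi.add_apply] at es
  rw [es]
  -- In the common corner the nesting parities are κ + a and κ + c for the two arcs and κ + a + c
  -- for the merged circle. The first arc is inside the second iff c = 1, the second inside the
  -- first iff a = 1, and not both occur.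
  generalize D.pot (D.arcFst b x).1 (D.cornerAt x k) = a at *
  generalize D.pot (D.arcSnd b x).1 (D.cornerAt x k) = c at *
  generalize D.pot Set.univ (D.cornerAt x k) = κ at *
  have k1 : ∀ κ a c : ZMod 2, (c = 1 → ¬ a = 1) → a = 1 →
      κ + c = κ + (a + c) + 1 ∧ κ + a = κ + (a + c) := by decide
  have k2 : ∀ κ a c : ZMod 2, ¬ a = 1 → c = 1 →
      κ + a = κ + (a + c) + 1 ∧ κ + c = κ + (a + c) := by decide
  have k3 : ∀ κ a c : ZMod 2, ¬ a = 1 → ¬ c = 1 →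
      κ + a = κ + (a + c) ∧ κ + c = κ + (a + c) := by decide
  by_cases ha : a = 1
  · simpa [ha, e0, e2] using k1 κ a c hnot ha
  · by_cases hc : c = 1
    · simpa [ha, hc, e0, e2] using k2 κ a c ha hc
    · simpa [ha, hc, e0, e2] using k3 κ a c ha hc

end Merges

end LinkDiagram

/-! ### Structure constants -/

/-- Indices are exponents of X: addition in `Fin 2` reduces by X² = t with carry i · j, and the sign
sees only the first factor. -/
lemma mul_bas (ε : ℕ) (i j : Fin 2) : mul ε (bas i ⊗ₜ[R] bas j) =
    ((-1 : R) ^ (ε * i.val) * t ^ (i.val * j.val)) • bas (i + j) := by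
  rw [← Module.Basis.tensorProduct_apply, mul, Module.Basis.constr_basis]
  fin_cases i <;> fin_cases j <;> simp [one, X]

lemma comul_bas (ε : ℕ) (i : Fin 2) : comul ε (bas i) =
    bas 1 ⊗ₜ[R] bas i + ((-1 : R) ^ ε * t ^ i.val) • (bas 0 ⊗ₜ[R] bas (i + 1)) := by
  rw [comul, Module.Basis.constr_basis]
  fin_cases i <;> simp [one, X]

lemma rescale_bas (k : ℕ) (i : Fin 2) : rescale k (bas i) = (-1 : R) ^ (k * i.val) • bas i := by
  rw [rescale, Module.Basis.constr_basis]
  fin_cases i <;> simp [one, X]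

namespace LinkDiagram

variable {D : LinkDiagram} {v w : D.Vertex} {x : Fin D.n}

/-! ### Monomials -/

/-- The tensor product of `1`s and `X`s given by the labels of the circles. -/
def mono (v : D.Vertex) (σ : D.Circle v → Fin 2) : D.Space v :=
  PiTensorProduct.tprod R fun c => bas (σ c)

lemma spaceBasis_apply (v : D.Vertex) (σ : D.Circle v → Fin 2) : D.spaceBasis v σ = mono v σ := by
  simp [spaceBasis, mono]

lemma hom_ext {M : Type*} [AddCommMonoid M] [Module R M] {f g : D.Space v →ₗ[R] M}
    (h : ∀ σ, f (mono v σ) = g (mono v σ)) : f = g :=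
  (D.spaceBasis v).ext fun σ => by rw [spaceBasis_apply, h]

/-- The labels of the circles of `w`, where the circles that are not circles of `v` get their
labels from `τ`. -/
def transfer (v w : D.Vertex) (σ : D.Circle v → Fin 2) (τ : D.Circle w → Fin 2) (c : D.Circle w) :
    Fin 2 :=
  open Classical in if h : c.1 ∈ (D.circleSetoid v).classes then σ ⟨c.1, h⟩ else τ c

lemma mergeMap_mono {ε : ℕ} {p q : D.Circle v} {r : D.Circle w}
    (hr : ∀ c : D.Circle w, c.1 ∈ (D.circleSetoid v).classes ↔ c ≠ r) (σ : D.Circle v → Fin 2) :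
    D.mergeMap v w ε p q (mono v σ) =
      ((-1 : R) ^ (ε * (σ p).val) * t ^ ((σ p).val * (σ q).val)) •
        mono w (transfer v w σ fun _ => σ p + σ q) := by
  classical
  rw [mergeMap, ← spaceBasis_apply, Module.Basis.constr_basis, mul_bas]
  generalize ((-1 : R) ^ (ε * (σ p).val) * t ^ ((σ p).val * (σ q).val)) = a
  -- Only the factor of the new circle `r` carries the scalar, so multilinearity in that slot pulls
  -- it out.
  rw [mono, ← Function.update_eq_self r fun c => bas (transfer v w σ (fun _ => σ p + σ q) c),
    ← MultilinearMap.map_update_smul]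
  congr 1
  ext1 c
  by_cases hc : c = r
  · subst hc
    have : c.1 ∉ (D.circleSetoid v).classes := fun h => (hr c).1 h rfl
    simp [transfer, this]
  · simp [transfer, (hr c).2 hc, hc]

lemma splitMap_mono {ε : ℕ} {p : D.Circle v} {p' q' : D.Circle w} (σ : D.Circle v → Fin 2) :
    D.splitMap v w ε p p' q' (mono v σ) =
      mono w (transfer v w σ (Function.update (Function.update 0 q' (σ p)) p' 1)) +
      ((-1 : R) ^ ε * t ^ (σ p).val) •
        mono w (transfer v w σ (Function.update (Function.update 0 q' (σ p + 1)) p' 0)) := by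
  classical
  rw [splitMap, ← spaceBasis_apply, Module.Basis.constr_basis, comul_bas, map_add, map_smul,
    ← Module.Basis.tensorProduct_apply, ← Module.Basis.tensorProduct_apply,
    Module.Basis.constr_basis, Module.Basis.constr_basis]
  have key : ∀ i j : Fin 2, (PiTensorProduct.tprod R fun c : D.Circle w =>
      if h : c.1 ∈ (D.circleSetoid v).classes then bas (σ ⟨c.1, h⟩)
        else if c = p' then bas i else if c = q' then bas j else one) =
      mono w (transfer v w σ (Function.update (Function.update 0 q' j) p' i)) := by
    intro i j
    rw [mono]
    congr 1
    ext1 c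
    simp only [transfer, Function.update_apply, Pi.zero_apply, one]
    split_ifs <;> rfl
  exact congrArg₂ (· + ·) (key _ _) (congrArg _ (key _ _))

lemma phi_mono (σ : D.Circle v → Fin 2) :
    D.phi v (mono v σ) = (∏ c, (-1 : R) ^ (D.nes v c * (σ c).val)) • mono v σ := by
  rw [phi, mono, PiTensorProduct.map_tprod, ← MultilinearMap.map_smul_univ]
  simp only [rescale_bas]

lemma phi_phi (a : D.Space v) : D.phi v (D.phi v a) = a := by
  suffices h : D.phi v ∘ₗ D.phi v = LinearMap.id from LinearMap.congr_fun h a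
  refine hom_ext fun σ => ?_
  rw [LinearMap.comp_apply, phi_mono, map_smul, phi_mono, smul_smul, ← Finset.prod_mul_distrib]
  simp [← mul_pow]

/-! ### Multiplication by the `X` of a circle -/

open Classical in
/-- The multiplication by `X` on the factor of the circle `c`. -/
def mulAt (v : D.Vertex) (c : D.Circle v) : D.Space v →ₗ[R] D.Space v :=
  (D.spaceBasis v).constr R fun σ =>
    (t ^ (σ c).val : R) • mono v (Function.update σ c (σ c + 1))

lemma mulAt_mono [DecidableEq (D.Circle v)] (c : D.Circle v) (σ : D.Circle v → Fin 2) :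
    mulAt v c (mono v σ) = (t ^ (σ c).val : R) • mono v (Function.update σ c (σ c + 1)) := by
  rw [mulAt, ← spaceBasis_apply, Module.Basis.constr_basis]
  congr!

/-- The map `f` commutes with the multiplications by the `X` on the circles through every edge `e`
up to the sign `(-1) ^ θ e`. -/
def Intertwines (θ : D.Edge → ℕ) (f : D.Space v →ₗ[R] D.Space w) : Prop :=
  ∀ e a, f (mulAt v (D.circleThrough v e) a) =
    (-1 : R) ^ θ e • mulAt w (D.circleThrough w e) (f a)

lemma intertwines_of_mono {θ : D.Edge → ℕ} {f : D.Space v →ₗ[R] D.Space w}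
    (h : ∀ e σ, f (mulAt v (D.circleThrough v e) (mono v σ)) =
      (-1 : R) ^ θ e • mulAt w (D.circleThrough w e) (f (mono v σ))) : Intertwines θ f :=
  fun e => LinearMap.congr_fun (f := f ∘ₗ mulAt v (D.circleThrough v e))
    (g := (-1 : R) ^ θ e • (mulAt w (D.circleThrough w e) ∘ₗ f)) (hom_ext (h e))

lemma Intertwines.comp {u : D.Vertex} {θ θ' : D.Edge → ℕ} {f : D.Space v →ₗ[R] D.Space w}
    {g : D.Space u →ₗ[R] D.Space v} (hf : Intertwines θ f) (hg : Intertwines θ' g) :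
    Intertwines (fun e => θ e + θ' e) (f ∘ₗ g) := fun e a => by
  rw [LinearMap.comp_apply, hg, map_smul, hf, smul_smul, pow_add, mul_comm]
  rfl

lemma Intertwines.smul {θ : D.Edge → ℕ} {f : D.Space v →ₗ[R] D.Space w} (hf : Intertwines θ f)
    (r : R) : Intertwines θ (r • f) := fun e a => by
  rw [LinearMap.smul_apply, hf, LinearMap.smul_apply, map_smul, smul_comm]

lemma neg_one_pow_eq {a b : ℕ} (h : (a : ZMod 2) = b) : (-1 : R) ^ a = (-1) ^ b := by
  rw [ZMod.natCast_eq_natCast_iff] at h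
  rw [neg_one_pow_eq_pow_mod_two, h, ← neg_one_pow_eq_pow_mod_two]

lemma Intertwines.congr {θ θ' : D.Edge → ℕ} {f : D.Space v →ₗ[R] D.Space w} (hf : Intertwines θ f)
    (h : ∀ e, (θ e : ZMod 2) = θ' e) : Intertwines θ' f := fun e a => by
  rw [hf, neg_one_pow_eq (h e)]

/-- Induction on the number of labels X: each monomial arises from 1 ⊗ ... ⊗ 1 by multiplications by
X. -/
lemma Intertwines.ext {θ : D.Edge → ℕ} {f g : D.Space v →ₗ[R] D.Space w} (hf : Intertwines θ f)
    (hg : Intertwines θ g) (h : f (mono v 0) = g (mono v 0)) : f = g := by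
  classical
  refine hom_ext fun σ => ?_
  induction hn : ∑ c, (σ c).val generalizing σ with
  | zero =>
    have : σ = 0 := funext fun c => by
      have := (Finset.sum_eq_zero_iff.1 hn) c (Finset.mem_univ c)
      exact Fin.val_eq_zero_iff.1 this
    rw [this, h]
  | succ n ih =>
    obtain ⟨c, -, hc⟩ : ∃ c ∈ Finset.univ, (σ c).val ≠ 0 :=
      Finset.exists_ne_zero_of_sum_ne_zero (by omega)
    have hc1 : σ c = 1 := by
      revert hc; generalize σ c = i; revert i; decide
    have hσ : mono v σ = mulAt v c (mono v (Function.update σ c 0)) := by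
      rw [mulAt_mono]
      simp [← hc1]
    obtain ⟨e, rfl⟩ := exists_eq_circleThrough c
    rw [hσ, hf, hg, ih]
    rw [← Finset.add_sum_erase _ _ (Finset.mem_univ (D.circleThrough v e))] at hn ⊢
    rw [hc1] at hn
    rw [Finset.sum_congr rfl fun c hc => by rw [Function.update_of_ne (Finset.ne_of_mem_erase hc)]]
    simp at hn ⊢
    omega

/-- On each factor the map is X ↦ ±X, which respects X² = t and is therefore an algebra
automorphism. -/
lemma intertwines_phi (v : D.Vertex) :
    Intertwines (fun e => D.nes v (D.circleThrough v e)) (D.phi v) := by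
  classical
  refine intertwines_of_mono fun e σ => ?_
  set c := D.circleThrough v e
  rw [mulAt_mono, map_smul, phi_mono, phi_mono, map_smul, mulAt_mono, smul_smul, smul_smul,
    smul_smul]
  congr 1
  rw [← Finset.mul_prod_erase _ _ (Finset.mem_univ c), ← Finset.mul_prod_erase (a := c) _
    (fun i => (-1 : R) ^ (D.nes v i * (σ i).val)) (Finset.mem_univ c)]
  rw [Finset.prod_congr rfl fun c hc => by rw [Function.update_of_ne (Finset.ne_of_mem_erase hc)]]
  rw [Function.update_self]
  have : (-1 : R) ^ (D.nes v c * (σ c + 1).val) =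
      (-1) ^ D.nes v c * (-1) ^ (D.nes v c * (σ c).val) := by
    rw [← pow_add]
    apply neg_one_pow_eq
    push_cast
    generalize σ c = i
    fin_cases i
    · simp
    · simp [CharTwo.add_self_eq_zero]
  rw [this]
  ring

variable {D : LinkDiagram} {v w : D.Vertex} {x : Fin D.n}

/-! ### Labels before and after a saddle -/

lemma transfer_of_mem {σ : D.Circle v → Fin 2} {τ : D.Circle w → Fin 2} {c : D.Circle v}
    {c' : D.Circle w} (h : c'.1 = c.1) : transfer v w σ τ c' = σ c := by
  have hc : c'.1 ∈ (D.circleSetoid v).classes := h ▸ c.2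
  rw [transfer, dif_pos hc]
  exact congrArg σ (Subtype.ext h)

lemma transfer_of_mem_classes {σ : D.Circle v → Fin 2} {τ : D.Circle w → Fin 2} {c : D.Circle w}
    (h : c.1 ∈ (D.circleSetoid v).classes) : transfer v w σ τ c = σ ⟨c.1, h⟩ := dif_pos h

lemma transfer_of_notMem {σ : D.Circle v → Fin 2} {τ : D.Circle w → Fin 2} {c : D.Circle w}
    (h : c.1 ∉ (D.circleSetoid v).classes) : transfer v w σ τ c = τ c := dif_neg h

lemma transfer_congr {σ : D.Circle v → Fin 2} {τ τ' : D.Circle w → Fin 2}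
    (h : ∀ c, c.1 ∉ (D.circleSetoid v).classes → τ c = τ' c) :
    transfer v w σ τ = transfer v w σ τ' := by
  ext1 c
  by_cases hc : c.1 ∈ (D.circleSetoid v).classes
  · rw [transfer_of_mem_classes hc, transfer_of_mem_classes hc]
  · rw [transfer_of_notMem hc, transfer_of_notMem hc, h c hc]

lemma transfer_update_of_eq [DecidableEq (D.Circle v)] [DecidableEq (D.Circle w)]
    {σ : D.Circle v → Fin 2} {τ : D.Circle w → Fin 2} {c : D.Circle v}
    {c' : D.Circle w} (h : c'.1 = c.1) (u : Fin 2) :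
    transfer v w (Function.update σ c u) τ = Function.update (transfer v w σ τ) c' u := by
  ext1 d
  by_cases hd : d = c'
  · subst hd
    rw [transfer_of_mem h, Function.update_self, Function.update_self]
  · rw [Function.update_of_ne hd]
    by_cases hm : d.1 ∈ (D.circleSetoid v).classes
    · rw [transfer_of_mem_classes hm, transfer_of_mem_classes hm,
        Function.update_of_ne]
      rintro rfl
      exact hd (Subtype.ext h.symm)
    · rw [transfer_of_notMem hm, transfer_of_notMem hm]

lemma transfer_update_of_notMem [DecidableEq (D.Circle v)]
    {σ : D.Circle v → Fin 2} {τ : D.Circle w → Fin 2} {c : D.Circle v}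
    (h : c.1 ∉ (D.circleSetoid w).classes) (u : Fin 2) :
    transfer v w (Function.update σ c u) τ = transfer v w σ τ := by
  ext1 d
  by_cases hm : d.1 ∈ (D.circleSetoid v).classes
  · rw [transfer_of_mem_classes hm, transfer_of_mem_classes hm,
      Function.update_of_ne]
    rintro rfl
    exact h d.2
  · rw [transfer_of_notMem hm, transfer_of_notMem hm]

lemma update_transfer [DecidableEq (D.Circle w)]
    {σ : D.Circle v → Fin 2} {τ : D.Circle w → Fin 2} {c : D.Circle w}
    (h : c.1 ∉ (D.circleSetoid v).classes) (u : Fin 2) :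
    Function.update (transfer v w σ τ) c u = transfer v w σ (Function.update τ c u) := by
  ext1 d
  by_cases hd : d = c
  · subst hd
    rw [Function.update_self, transfer_of_notMem h, Function.update_self]
  · rw [Function.update_of_ne hd]
    by_cases hm : d.1 ∈ (D.circleSetoid v).classes
    · rw [transfer_of_mem_classes hm, transfer_of_mem_classes hm]
    · rw [transfer_of_notMem hm, transfer_of_notMem hm, Function.update_of_ne hd]

variable (D) in
/-- The circles `p` and `q` are the two circles at the crossing `x`. -/
def AreArcs (v : D.Vertex) (x : Fin D.n) (p q : D.Circle v) : Prop :=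
  (p = D.arcFst v x ∧ q = D.arcSnd v x) ∨ (p = D.arcSnd v x ∧ q = D.arcFst v x)

lemma areArcs_arcs (v : D.Vertex) (x : Fin D.n) : D.AreArcs v x (D.arcFst v x) (D.arcSnd v x) :=
  Or.inl ⟨rfl, rfl⟩

lemma areArcs_innerOuter (v : D.Vertex) (x : Fin D.n) :
    D.AreArcs v x (D.innerOuter v x).1 (D.innerOuter v x).2 := by
  unfold innerOuter
  split_ifs
  · exact Or.inr ⟨rfl, rfl⟩
  · exact Or.inl ⟨rfl, rfl⟩

namespace Merges

variable {b s : D.Vertex} {p q : D.Circle b}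

lemma ne_of_areArcs (h : Merges b s x) (hpq : D.AreArcs b x p q) : p ≠ q := by
  obtain ⟨rfl, rfl⟩ | ⟨rfl, rfl⟩ := hpq
  exacts [h.arcFst_ne_arcSnd, h.arcFst_ne_arcSnd.symm]

lemma mem_merged_iff (h : Merges b s x) (hpq : D.AreArcs b x p q) (e : D.Edge) :
    e ∈ (D.arcFst s x).1 ↔ e ∈ p.1 ∨ e ∈ q.1 := by
  rw [h.mem_arcFst_iff]
  obtain ⟨rfl, rfl⟩ | ⟨rfl, rfl⟩ := hpq
  exacts [Iff.rfl, or_comm]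

lemma circleThrough_eq_merged (h : Merges b s x) (hpq : D.AreArcs b x p q) {e : D.Edge}
    (he : e ∈ p.1 ∨ e ∈ q.1) : D.circleThrough s e = D.arcFst s x :=
  (mem_iff_eq_circleThrough.1 ((h.mem_merged_iff hpq e).2 he)).symm

lemma circleThrough_eq_of_notMem (h : Merges b s x) (hpq : D.AreArcs b x p q) {e : D.Edge}
    (hp : e ∉ p.1) (hq : e ∉ q.1) : (D.circleThrough s e).1 = (D.circleThrough b e).1 := by
  obtain ⟨rfl, rfl⟩ | ⟨rfl, rfl⟩ := hpq
  exacts [h.circleThrough_eq hp hq, h.circleThrough_eq hq hp]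

lemma mem_classes_iff_ne (h : Merges b s x) (c : D.Circle s) :
    c.1 ∈ (D.circleSetoid b).classes ↔ c ≠ D.arcFst s x := by
  constructor
  · rintro hc rfl
    have h0 : (⟨_, hc⟩ : D.Circle b) = D.arcFst b x :=
      mem_iff_eq_circleThrough.1 ((h.mem_arcFst_iff _).2 (Or.inl (self_mem_circleThrough _)))
    have h2 : (⟨_, hc⟩ : D.Circle b) = D.arcSnd b x :=
      mem_iff_eq_circleThrough.1 ((h.mem_arcFst_iff _).2 (Or.inr (self_mem_circleThrough _)))
    exact h.arcFst_ne_arcSnd (h0.symm.trans h2)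
  · intro hc
    obtain ⟨e, rfl⟩ := exists_eq_circleThrough c
    have he : ¬ (e ∈ (D.arcFst b x).1 ∨ e ∈ (D.arcSnd b x).1) := fun he =>
      hc (h.circleThrough_eq_merged (areArcs_arcs b x) he)
    rw [h.circleThrough_eq (fun h' => he (Or.inl h')) fun h' => he (Or.inr h')]
    exact (D.circleThrough b e).2

lemma notMem_classes (h : Merges b s x) : (D.arcFst s x).1 ∉ (D.circleSetoid b).classes :=
  fun h' => (h.mem_classes_iff_ne _).1 h' rfl

lemma fst_notMem_classes (h : Merges b s x) (hpq : D.AreArcs b x p q) :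
    p.1 ∉ (D.circleSetoid s).classes := by
  intro hp
  have h02 : D.edgeAt x 0 ∈ p.1 ∧ D.edgeAt x 2 ∈ p.1 := by
    have hcl := fun e f => circle_closed (⟨p.1, hp⟩ : D.Circle s) e f
    obtain ⟨rfl, rfl⟩ | ⟨rfl, rfl⟩ := hpq
    · exact ⟨self_mem_circleThrough _, hcl _ _ h.rel_zero_two (self_mem_circleThrough _)⟩
    · exact ⟨hcl _ _ ((D.rel s).symm h.rel_zero_two) (self_mem_circleThrough _),
        self_mem_circleThrough _⟩
  exact h.arcFst_ne_arcSnd ((mem_iff_eq_circleThrough.1 h02.1).symm.trans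
    (mem_iff_eq_circleThrough.1 h02.2))

end Merges

lemma AreArcs.symm {p q : D.Circle v} (h : D.AreArcs v x p q) : D.AreArcs v x q p :=
  (Or.symm h).imp And.symm And.symm

/-! ### Saddles and multiplications -/

open Classical in
-- m_ε(Xa ⊗ b) = (-1)^ε X m_ε(a ⊗ b), while an X in the second factor comes out without a sign.
lemma Merges.intertwines_mergeMap (h : Merges v w x) {p q : D.Circle v} (hpq : D.AreArcs v x p q)
    (ε : ℕ) : Intertwines (fun e => if e ∈ p.1 then ε else 0) (D.mergeMap v w ε p q) := by
  have hr := h.mem_classes_iff_ne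
  have hne := h.ne_of_areArcs hpq
  have htr : ∀ (σ : D.Circle v → Fin 2) (k u : Fin 2),
      transfer v w σ (Function.update (fun _ => k) (D.arcFst w x) u) = transfer v w σ fun _ => u := by
    intro σ k u
    refine transfer_congr fun c hc => ?_
    obtain rfl : c = D.arcFst w x := by rwa [hr, not_not] at hc
    rw [Function.update_self]
  refine intertwines_of_mono fun e σ => ?_
  rw [mulAt_mono, map_smul, mergeMap_mono hr, mergeMap_mono hr, map_smul, mulAt_mono, smul_smul,
    smul_smul, smul_smul]
  by_cases hep : e ∈ p.1
  · rw [if_pos hep, h.circleThrough_eq_merged hpq (Or.inl hep), ← mem_iff_eq_circleThrough.1 hep,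
      transfer_update_of_notMem (h.fst_notMem_classes hpq), transfer_of_notMem h.notMem_classes,
      update_transfer h.notMem_classes, htr, Function.update_self, Function.update_of_ne hne.symm]
    congr 1
    · generalize σ p = i, σ q = j
      fin_cases i <;> fin_cases j <;> simp [← mul_pow, ← mul_assoc]
    · rw [add_right_comm]
  by_cases heq : e ∈ q.1
  · rw [if_neg hep, h.circleThrough_eq_merged hpq (Or.inr heq), ← mem_iff_eq_circleThrough.1 heq,
      transfer_update_of_notMem (h.fst_notMem_classes hpq.symm),
      transfer_of_notMem h.notMem_classes,
      update_transfer h.notMem_classes, htr, Function.update_self, Function.update_of_ne hne]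
    congr 1
    · generalize σ p = i, σ q = j
      fin_cases i <;> fin_cases j <;> simp [mul_comm]
    · rw [add_assoc]
  · have hc := h.circleThrough_eq_of_notMem hpq hep heq
    have hpc : p ≠ D.circleThrough v e := fun h => hep (mem_iff_eq_circleThrough.2 h)
    have hqc : q ≠ D.circleThrough v e := fun h => heq (mem_iff_eq_circleThrough.2 h)
    rw [if_neg hep, transfer_of_mem hc, Function.update_of_ne hpc, Function.update_of_ne hqc,
      transfer_update_of_eq hc]
    congr 1
    ring

open Classical in
-- Δ_ε(Xa) equals (1 ⊗ X) Δ_ε(a) and also (-1)^ε (X ⊗ 1) Δ_ε(a).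
lemma Merges.intertwines_splitMap (h : Merges w v x) {p q : D.Circle w} (hpq : D.AreArcs w x p q)
    (ε : ℕ) : Intertwines (fun e => if e ∈ p.1 then ε else 0)
      (D.splitMap v w ε (D.arcFst v x) p q) := by
  have hne := h.ne_of_areArcs hpq
  have hp := h.fst_notMem_classes hpq
  have hq := h.fst_notMem_classes hpq.symm
  have hε : (-1 : R) ^ ε * (-1) ^ ε = 1 := by simp [← mul_pow]
  have h11 : (1 + 1 : Fin 2) = 0 := rfl
  have h01 : ∀ i : Fin 2, i = 0 ∨ i = 1 := by decide
  refine intertwines_of_mono fun e σ => ?_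
  rw [mulAt_mono, map_smul, splitMap_mono, splitMap_mono, map_add, map_smul, mulAt_mono, mulAt_mono]
  by_cases hep : e ∈ p.1
  · rw [if_pos hep, h.circleThrough_eq_merged hpq (Or.inl hep), ← mem_iff_eq_circleThrough.1 hep,
      transfer_update_of_notMem h.notMem_classes, transfer_update_of_notMem h.notMem_classes,
      transfer_of_notMem hp, transfer_of_notMem hp, update_transfer hp, update_transfer hp]
    simp only [Function.update_self, Function.update_idem]
    generalize σ (D.arcFst v x) = i
    obtain rfl | rfl := h01 i <;>
      simp only [h11, zero_add, Fin.val_zero, Fin.val_one, pow_zero, pow_one, one_smul, mul_one,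
        one_mul, smul_add, smul_smul]
    · rw [hε, one_smul, add_comm]
    · rw [← mul_assoc, hε, one_mul, mul_comm t, add_comm]
  by_cases heq : e ∈ q.1
  · rw [if_neg hep, h.circleThrough_eq_merged hpq (Or.inr heq), ← mem_iff_eq_circleThrough.1 heq,
      transfer_update_of_notMem h.notMem_classes, transfer_update_of_notMem h.notMem_classes,
      transfer_of_notMem hq, transfer_of_notMem hq, update_transfer hq, update_transfer hq]
    simp only [Function.update_self, Function.update_comm hne, Function.update_idem,
      Function.update_of_ne hne.symm]
    generalize σ (D.arcFst v x) = i
    obtain rfl | rfl := h01 i <;>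
      simp only [h11, zero_add, Fin.val_zero, Fin.val_one, pow_zero, pow_one, one_smul, mul_one,
        one_mul, smul_add, smul_smul]
    rw [mul_comm t]
  · have hc := (h.circleThrough_eq_of_notMem hpq hep heq).symm
    have hrc : D.arcFst v x ≠ D.circleThrough v e := by
      intro hr
      have := (h.mem_merged_iff hpq e).1 (mem_iff_eq_circleThrough.2 hr)
      tauto
    rw [if_neg hep, transfer_of_mem hc, transfer_of_mem hc, Function.update_of_ne hrc,
      transfer_update_of_eq hc, transfer_update_of_eq hc]
    simp only [pow_zero, one_mul, smul_add, smul_smul]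
    rw [mul_comm]

lemma Merges.mergeMap_one (h : Merges v w x) (p q : D.Circle v) (ε : ℕ) :
    D.mergeMap v w ε p q (mono v 0) = mono w 0 := by
  rw [mergeMap_mono h.mem_classes_iff_ne]
  simp only [Pi.zero_apply, Fin.val_zero, mul_zero, pow_zero, mul_one, one_smul, add_zero]
  congr 1
  ext1 c
  unfold transfer
  split_ifs <;> rfl

lemma Merges.splitMap_one (h : Merges w v x) {p q : D.Circle w} (hpq : D.AreArcs w x p q)
    (ε : ℕ) : D.splitMap v w ε (D.arcFst v x) p q (mono v 0) =
      mulAt w p (mono w 0) + (-1 : R) ^ ε • mulAt w q (mono w 0) := by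
  classical
  have hp := h.fst_notMem_classes hpq
  have hq := h.fst_notMem_classes hpq.symm
  have hne := h.ne_of_areArcs hpq
  have h0 : transfer v w 0 (0 : D.Circle w → Fin 2) = 0 := by
    ext1 c
    unfold transfer
    split_ifs <;> rfl
  have hz : ∀ c, Function.update (0 : D.Circle w → Fin 2) c 0 = 0 := fun c =>
    Function.update_eq_self c _
  rw [splitMap_mono, mulAt_mono, mulAt_mono, Pi.zero_apply, hz, Function.update_comm hne.symm, hz,
    ← update_transfer hp, ← update_transfer hq, h0]
  simp

variable {D : LinkDiagram} {u v w : D.Vertex} {x y : Fin D.n}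

/-! ### The maps of the two systems on a saddle -/

lemma Merges.khSaddle_eq (h : Merges v w x) :
    D.khSaddle x v w = D.mergeMap v w 0 (D.arcFst v x) (D.arcSnd v x) :=
  if_pos h.arcFst_ne_arcSnd

lemma Merges.khSaddle_eq' (h : Merges w v x) :
    D.khSaddle x v w = D.splitMap v w 0 (D.arcFst v x) (D.arcFst w x) (D.arcSnd w x) :=
  if_neg (not_not.2 h.arcFst_eq_arcSnd)

lemma Merges.nestedSaddle_eq (h : Merges v w x) : D.nestedSaddle x v w =
    D.mergeMap v w (D.nestedAt v x) (D.innerOuter v x).1 (D.innerOuter v x).2 :=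
  if_pos h.arcFst_ne_arcSnd

lemma Merges.nestedSaddle_eq' (h : Merges w v x) : D.nestedSaddle x v w =
    D.splitMap v w (D.nestedAt w x) (D.arcFst v x) (D.innerOuter w x).1 (D.innerOuter w x).2 :=
  if_neg (not_not.2 h.arcFst_eq_arcSnd)

lemma intertwines_khSaddle (h : Merges v w x ∨ Merges w v x) :
    Intertwines (fun _ => 0) (D.khSaddle x v w) := by
  classical
  obtain h | h := h
  · rw [h.khSaddle_eq]
    exact (h.intertwines_mergeMap (areArcs_arcs v x) 0).congr fun e => by simp
  · rw [h.khSaddle_eq']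
    exact (h.intertwines_splitMap (areArcs_arcs w x) 0).congr fun e => by simp

open Classical in
-- Only the inner one of two nested circles changes its nesting parity in the merge. This makes the
-- sign of a nested saddle the difference of the signs of `phi` at its two ends.
lemma Merges.natCast_nes_add {b s : D.Vertex} (h : Merges b s x) (e : D.Edge) :
    ((if e ∈ (D.innerOuter b x).1.1 then D.nestedAt b x else 0 : ℕ) : ZMod 2) =
      D.nes b (D.circleThrough b e) + D.nes s (D.circleThrough s e) := by
  have hio := areArcs_innerOuter b x
  obtain ⟨h1, h2⟩ := h.natCast_nes_innerOuter
  by_cases hep : e ∈ (D.innerOuter b x).1.1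
  · rw [if_pos hep, ← mem_iff_eq_circleThrough.1 hep, h.circleThrough_eq_merged hio (Or.inl hep),
      h1, add_right_comm, CharTwo.add_self_eq_zero, zero_add]
  rw [if_neg hep, Nat.cast_zero]
  by_cases heq : e ∈ (D.innerOuter b x).2.1
  · rw [← mem_iff_eq_circleThrough.1 heq, h.circleThrough_eq_merged hio (Or.inr heq),
      h2, CharTwo.add_self_eq_zero]
  · have hn : e ∉ (D.arcFst b x).1 ∧ e ∉ (D.arcSnd b x).1 := by
      obtain ⟨h3, h4⟩ | ⟨h3, h4⟩ := hio
      · rw [h3] at hep; rw [h4] at heq; exact ⟨hep, heq⟩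
      · rw [h3] at hep; rw [h4] at heq; exact ⟨heq, hep⟩
    rw [h.natCast_nes_eq hn.1 hn.2, CharTwo.add_self_eq_zero]

lemma intertwines_nestedSaddle (h : Merges v w x ∨ Merges w v x) :
    Intertwines (fun e => D.nes v (D.circleThrough v e) + D.nes w (D.circleThrough w e))
      (D.nestedSaddle x v w) := by
  classical
  obtain h | h := h
  · rw [h.nestedSaddle_eq]
    refine (h.intertwines_mergeMap (areArcs_innerOuter v x) _).congr fun e => ?_
    rw [h.natCast_nes_add, Nat.cast_add]
  · rw [h.nestedSaddle_eq']
    refine (h.intertwines_splitMap (areArcs_innerOuter w x) _).congr fun e => ?_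
    rw [h.natCast_nes_add, Nat.cast_add, add_comm]

variable (D) in
/-- The sum of the multiplications by `X` on the two circles at a crossing. -/
def mulArcs (v : D.Vertex) (x : Fin D.n) : D.Space v →ₗ[R] D.Space v :=
  mulAt v (D.arcFst v x) + mulAt v (D.arcSnd v x)

lemma AreArcs.mulArcs_eq {p q : D.Circle v} (h : D.AreArcs v x p q) :
    D.mulArcs v x = mulAt v p + mulAt v q := by
  obtain ⟨rfl, rfl⟩ | ⟨rfl, rfl⟩ := h
  exacts [rfl, add_comm _ _]

lemma Merges.khSaddle_one (h : Merges v w x) : D.khSaddle x v w (mono v 0) = mono w 0 := by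
  rw [h.khSaddle_eq, h.mergeMap_one]

lemma Merges.khSaddle_one' (h : Merges w v x) :
    D.khSaddle x v w (mono v 0) = D.mulArcs w x (mono w 0) := by
  rw [h.khSaddle_eq', h.splitMap_one (areArcs_arcs w x), pow_zero, one_smul]
  rfl

lemma phi_one (v : D.Vertex) : D.phi v (mono v 0) = mono v 0 := by
  rw [phi_mono]
  simp

/-- The maps `phi` transform the nested system into Khovanov's up to signs on the saddles. -/
lemma exists_phi_comp_nestedSaddle (h : Merges v w x ∨ Merges w v x) :
    ∃ s : ℤˣ, D.phi w ∘ₗ D.nestedSaddle x v w = ((s : ℤ) : R) • (D.khSaddle x v w ∘ₗ D.phi v) := by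
  suffices hs : ∃ s : ℤˣ, D.phi w (D.nestedSaddle x v w (mono v 0)) =
      ((s : ℤ) : R) • D.khSaddle x v w (mono v 0) by
    obtain ⟨s, hs⟩ := hs
    have h1 := (intertwines_phi w).comp (intertwines_nestedSaddle h)
    have h2 := ((intertwines_khSaddle h).comp (intertwines_phi v)).smul ((s : ℤ) : R)
    refine ⟨s, h1.ext (h2.congr fun e => ?_) ?_⟩
    · push_cast
      rw [add_left_comm, CharTwo.add_self_eq_zero, add_zero, zero_add]
    · rw [LinearMap.comp_apply, hs, LinearMap.smul_apply, LinearMap.comp_apply, phi_one]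
  obtain h | h := h
  · refine ⟨1, ?_⟩
    rw [h.nestedSaddle_eq, h.mergeMap_one, phi_one, h.khSaddle_one]
    simp
  · have hio := areArcs_innerOuter w x
    obtain ⟨h1, h2⟩ := h.natCast_nes_innerOuter
    -- A split sends 1 to X on the inner circle plus (-1)^nested times X on the outer one. Since the
    -- nesting parities differ by `nestedAt`, `phi` gives both terms the sign of the inner circle.
    refine ⟨(-1) ^ D.nes w (D.innerOuter w x).1, ?_⟩
    rw [h.nestedSaddle_eq', h.splitMap_one hio, h.khSaddle_one', hio.mulArcs_eq]
    generalize (D.innerOuter w x).1 = p, (D.innerOuter w x).2 = q at *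
    obtain ⟨e, rfl⟩ := exists_eq_circleThrough p
    obtain ⟨f, rfl⟩ := exists_eq_circleThrough q
    have h3 : (-1 : R) ^ D.nestedAt w x * (-1) ^ D.nes w (D.circleThrough w f) =
        (-1) ^ D.nes w (D.circleThrough w e) := by
      rw [← pow_add]
      apply neg_one_pow_eq
      rw [h1, Nat.cast_add, h2, add_comm]
    rw [map_add, map_smul, intertwines_phi, intertwines_phi, phi_one, smul_smul, h3]
    simp

/-! ### Faces of the cube -/

lemma mulAt_comm (c d : D.Circle v) (a : D.Space v) :
    mulAt v c (mulAt v d a) = mulAt v d (mulAt v c a) := by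
  classical
  suffices h : mulAt v c ∘ₗ mulAt v d = mulAt v d ∘ₗ mulAt v c from LinearMap.congr_fun h a
  refine hom_ext fun σ => ?_
  by_cases hcd : c = d
  · rw [hcd]
  simp only [LinearMap.comp_apply, mulAt_mono, map_smul, smul_smul, Function.update_of_ne hcd,
    Function.update_of_ne (Ne.symm hcd)]
  rw [Function.update_comm hcd, mul_comm]

lemma mulArcs_comm (a : D.Space v) :
    D.mulArcs v x (D.mulArcs v y a) = D.mulArcs v y (D.mulArcs v x a) := by
  simp only [mulArcs, LinearMap.add_apply, map_add, mulAt_comm (D.arcFst v x),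
    mulAt_comm (D.arcSnd v x)]
  abel

lemma khSaddle_mulArcs (h : Merges v w y ∨ Merges w v y) (x : Fin D.n) (a : D.Space v) :
    D.khSaddle y v w (D.mulArcs v x a) = D.mulArcs w x (D.khSaddle y v w a) := by
  have hi := intertwines_khSaddle h
  simp only [mulArcs, LinearMap.add_apply, map_add]
  refine congrArg₂ _ ?_ ?_
  · exact (hi (D.edgeAt x 0) a).trans (by rw [pow_zero, one_smul]; rfl)
  · exact (hi (D.edgeAt x 2) a).trans (by rw [pow_zero, one_smul]; rfl)

lemma Merges.not_merges (h : Merges v w x) : ¬ Merges w v x := fun h' => h'.1 h.rel_zero_two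

variable (D) in
/-- The resolution `u` has the same circles at the crossings `x` and `y`. -/
def SameArcs (u : D.Vertex) (x y : Fin D.n) : Prop :=
  (D.rel u (D.edgeAt x 0) (D.edgeAt y 0) ∧ D.rel u (D.edgeAt x 2) (D.edgeAt y 2)) ∨
    (D.rel u (D.edgeAt x 0) (D.edgeAt y 2) ∧ D.rel u (D.edgeAt x 2) (D.edgeAt y 0))

lemma SameArcs.mulArcs_eq (h : D.SameArcs u x y) : D.mulArcs u x = D.mulArcs u y := by
  unfold mulArcs arcFst arcSnd
  obtain ⟨h1, h2⟩ | ⟨h1, h2⟩ := h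
  · rw [circleThrough_eq_iff.2 h1, circleThrough_eq_iff.2 h2]
  · rw [circleThrough_eq_iff.2 h1, circleThrough_eq_iff.2 h2, add_comm]

/-- Two different classes that lie in the union of two classes are these two classes. -/
lemma sameArcs_of_merges {b s : D.Vertex} (h : Merges b s x)
    (hs : D.rel s (D.edgeAt y 0) (D.edgeAt y 2)) (hb : ¬ D.rel b (D.edgeAt y 0) (D.edgeAt y 2)) :
    D.SameArcs b x y := by
  obtain ⟨h0, h2⟩ := ((h.2 _ _).1 hs).resolve_left hb
  have tr : ∀ {a b' c}, D.rel b a b' → D.rel b a c → D.rel b b' c := fun h h' =>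
    (D.rel b).trans ((D.rel b).symm h) h'
  obtain h0 | h0 := h0 <;> obtain h2 | h2 := h2
  exacts [(hb (tr h0 h2)).elim, Or.inl ⟨h0, h2⟩, Or.inr ⟨h2, h0⟩, (hb (tr h0 h2)).elim]

lemma SameArcs.rel_of_rel (h : D.SameArcs v x y) (hle : D.rel v ≤ D.rel w)
    (hy : D.rel w (D.edgeAt y 0) (D.edgeAt y 2)) : D.rel w (D.edgeAt x 0) (D.edgeAt x 2) := by
  obtain ⟨h0, h2⟩ | ⟨h0, h2⟩ := h
  · exact (D.rel w).trans (hle h0) ((D.rel w).trans hy ((D.rel w).symm (hle h2)))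
  · exact (D.rel w).trans (hle h0) ((D.rel w).trans ((D.rel w).symm hy) ((D.rel w).symm (hle h2)))

lemma SameArcs.symm (h : D.SameArcs v x y) : D.SameArcs v y x := by
  have sy : ∀ {a b}, D.rel v a b → D.rel v b a := fun h => (D.rel v).symm h
  obtain ⟨h0, h2⟩ | ⟨h0, h2⟩ := h
  exacts [Or.inl ⟨sy h0, sy h2⟩, Or.inr ⟨sy h2, sy h0⟩]

variable {vx vy : D.Vertex}

/-- If the saddle at `y` is a merge before and a split after the saddle at `x`, then so is the
saddle at `x` before and after the saddle at `y`. -/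
lemma face_of_merges_of_splits (hA : Merges v vx x ∨ Merges vx v x)
    (hD : Merges vy u x ∨ Merges u vy x) (hC : Merges v vy y) (hB : Merges u vx y) :
    Merges v vx x ∧ Merges u vy x ∧ D.SameArcs u x y := by
  -- A split at `x` could not join the two circles at `y`, which are distinct in `v` and equal in
  -- `vx`.
  have hA' : Merges v vx x := hA.resolve_right fun h => hC.1 (h.rel_of_rel hB.rel_zero_two)
  have hs := sameArcs_of_merges hA' hB.rel_zero_two hC.1
  have hx : D.rel vy (D.edgeAt x 0) (D.edgeAt x 2) :=
    hs.rel_of_rel (fun _ _ h => hC.rel_of_rel h) hC.rel_zero_two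
  have hD' : Merges u vy x := hD.resolve_left fun h => h.1 hx
  exact ⟨hA', hD', (sameArcs_of_merges hB hA'.rel_zero_two hD'.1).symm⟩

/-- If the saddle at `y` is a split before and a merge after the saddle at `x`, then so is the
saddle at `x` before and after the saddle at `y`. -/
lemma face_of_splits_of_merges (hA : Merges v vx x ∨ Merges vx v x)
    (hD : Merges vy u x ∨ Merges u vy x) (hC : Merges vy v y) (hB : Merges vx u y) :
    Merges vx v x ∧ Merges vy u x ∧ D.SameArcs u x y := by
  have hA' : Merges vx v x := hA.resolve_left fun h => hB.1 (h.rel_of_rel hC.rel_zero_two)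
  have hs := sameArcs_of_merges hA' hC.rel_zero_two hB.1
  have hx : D.rel u (D.edgeAt x 0) (D.edgeAt x 2) :=
    hs.rel_of_rel (fun _ _ h => hB.rel_of_rel h) hB.rel_zero_two
  have hD' : Merges vy u x := hD.resolve_right fun h => h.1 hx
  refine ⟨hA', hD', ?_⟩
  exact hs.imp (fun h => ⟨hB.rel_of_rel h.1, hB.rel_of_rel h.2⟩)
    fun h => ⟨hB.rel_of_rel h.1, hB.rel_of_rel h.2⟩

/-- By trivial signs it suffices to evaluate on 1 ⊗ ... ⊗ 1, where merges do nothing and each split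
contributes a factor `mulArcs`. If opposite edges are of the same kind, the factors agree up to
order; otherwise one factor remains on each path, at `x` or at `y`, and both crossings meet the same
circles of `u`. -/
lemma khSaddle_comm (hA : Merges v vx x ∨ Merges vx v x) (hB : Merges vx u y ∨ Merges u vx y)
    (hC : Merges v vy y ∨ Merges vy v y) (hD : Merges vy u x ∨ Merges u vy x) :
    D.khSaddle y vx u ∘ₗ D.khSaddle x v vx = D.khSaddle x vy u ∘ₗ D.khSaddle y v vy := by
  refine ((intertwines_khSaddle hB).comp (intertwines_khSaddle hA)).ext
    ((intertwines_khSaddle hD).comp (intertwines_khSaddle hC)) ?_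
  have eB := khSaddle_mulArcs hB x
  have eD := khSaddle_mulArcs hD y
  simp only [LinearMap.comp_apply]
  rcases id hB with hB' | hB' <;> rcases id hC with hC' | hC'
  · rcases id hA with hA' | hA' <;> rcases id hD with hD' | hD'
    · rw [hA'.khSaddle_one, hB'.khSaddle_one, hC'.khSaddle_one, hD'.khSaddle_one]
    · exact (hB'.not_merges (face_of_merges_of_splits hC hB hA' hD').2.1).elim
    · exact (hC'.not_merges (face_of_splits_of_merges hC hB hA' hD').1).elim
    · rw [hA'.khSaddle_one', eB, hB'.khSaddle_one, hC'.khSaddle_one, hD'.khSaddle_one']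
  · obtain ⟨hA', hD', hs⟩ := face_of_splits_of_merges hA hD hC' hB'
    rw [hA'.khSaddle_one', eB, hB'.khSaddle_one, hC'.khSaddle_one', eD, hD'.khSaddle_one,
      hs.mulArcs_eq]
  · obtain ⟨hA', hD', hs⟩ := face_of_merges_of_splits hA hD hC' hB'
    rw [hA'.khSaddle_one, hB'.khSaddle_one', hC'.khSaddle_one, hD'.khSaddle_one', hs.mulArcs_eq]
  · rcases id hA with hA' | hA' <;> rcases id hD with hD' | hD'
    · rw [hA'.khSaddle_one, hB'.khSaddle_one', hC'.khSaddle_one', eD, hD'.khSaddle_one]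
    · exact ((face_of_merges_of_splits hC hB hA' hD').1.not_merges hC').elim
    · exact ((face_of_splits_of_merges hC hB hA' hD').2.1.not_merges hB').elim
    · rw [hA'.khSaddle_one', eB, hB'.khSaddle_one', hC'.khSaddle_one', eD, hD'.khSaddle_one',
        mulArcs_comm]

/-! ### The augmentation -/

/-- The additive map that sends `t` and all monomials to `1`. -/
def aug (v : D.Vertex) : D.Space v →+ ℤ :=
  (Polynomial.evalRingHom (1 : ℤ)).toAddMonoidHom.comp
    ((D.spaceBasis v).constr R fun _ => (1 : R)).toAddMonoidHom

lemma aug_smul (r : R) (a : D.Space v) : aug v (r • a) = r.eval 1 * aug v a := by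
  simp [aug]

lemma aug_mono (σ : D.Circle v → Fin 2) : aug v (mono v σ) = 1 := by
  simp [aug, ← spaceBasis_apply]

lemma aug_mulAt (c : D.Circle v) (a : D.Space v) : aug v (mulAt v c a) = aug v a := by
  classical
  rw [← (D.spaceBasis v).sum_repr a]
  simp only [map_sum, map_smul, aug_smul, spaceBasis_apply, mulAt_mono, aug_mono]
  simp

lemma aug_mulArcs (a : D.Space v) : aug v (D.mulArcs v x a) = 2 * aug v a := by
  rw [mulArcs, LinearMap.add_apply, map_add, aug_mulAt, aug_mulAt, two_mul]

/-- The value is 2 to the number of splits. Without this a face could both commute and anticommute.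
-/
lemma aug_khSaddle_khSaddle_ne (hA : Merges v vx x ∨ Merges vx v x)
    (hB : Merges vx u y ∨ Merges u vx y) :
    aug u (D.khSaddle y vx u (D.khSaddle x v vx (mono v 0))) ≠ 0 := by
  have eB := khSaddle_mulArcs hB x
  obtain hA | hA := hA <;> obtain hB | hB := hB
  · simp [hA.khSaddle_one, hB.khSaddle_one, aug_mono]
  · simp [hA.khSaddle_one, hB.khSaddle_one', aug_mono, aug_mulArcs]
  · simp [hA.khSaddle_one', eB, hB.khSaddle_one, aug_mono, aug_mulArcs]
  · simp [hA.khSaddle_one', eB, hB.khSaddle_one', aug_mono, aug_mulArcs]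

variable {D : LinkDiagram}

/-! ### Signs on the cube -/

lemma flip_apply_of_ne {v : D.Vertex} {x y : Fin D.n} (h : x ≠ y) : D.flip v x y = v y :=
  Function.update_of_ne h.symm _ _

lemma flip_comm {v : D.Vertex} {x y : Fin D.n} (h : x ≠ y) :
    D.flip (D.flip v x) y = D.flip (D.flip v y) x := Function.update_comm h _ _ _

lemma merges_flip {v : D.Vertex} {x : Fin D.n} (h : v x = false) :
    Merges v (D.flip v x) x ∨ Merges (D.flip v x) v x :=
  merges_or_merges (fun _ hy => (flip_apply_of_ne (Ne.symm hy)).symm) (by simp [h])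

/-- A `1`-cocycle on the cube is a coboundary. -/
lemma exists_eq_mul_of_cocycle {g : D.Vertex → Fin D.n → ℤˣ}
    (hg : ∀ v x y, x ≠ y → v x = false → v y = false →
      g v x * g (D.flip v x) y = g v y * g (D.flip v y) x) :
    ∃ η : D.Vertex → ℤˣ, ∀ v x, v x = false → η (D.flip v x) = η v * g v x := by
  classical
  suffices h : ∀ S : Finset (Fin D.n), ∃ η : D.Vertex → ℤˣ, ∀ v, ∀ x ∈ S, v x = false →
      η (D.flip v x) = η v * g v x by
    obtain ⟨η, hη⟩ := h Finset.univ
    exact ⟨η, fun v x => hη v x (Finset.mem_univ x)⟩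
  intro S
  induction S using Finset.induction_on with
  | empty => exact ⟨1, by simp⟩
  | insert a S ha ih =>
    obtain ⟨η, hη⟩ := ih
    -- Keep η on the facet where `a` is 0 and transport it along the edges in direction `a`. The
    -- cocycle condition on faces containing `a` preserves the equations already achieved.
    refine ⟨fun v => if v a = true then
      η (Function.update v a false) * g (Function.update v a false) a else η v, ?_⟩
    intro v x hx hvx
    by_cases hxa : x = a
    · subst hxa
      have : Function.update (D.flip v x) x false = v := by
        rw [flip, Function.update_idem, ← hvx, Function.update_eq_self]
      simp [hvx, this]
    have hxS : x ∈ S := (Finset.mem_insert.1 hx).resolve_left hxa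
    simp only [flip_apply_of_ne hxa]
    by_cases hva : v a = true
    · rw [if_pos hva, if_pos hva]
      set u : D.Vertex := Function.update v a false
      have h1 : Function.update (D.flip v x) a false = D.flip u x := Function.update_comm hxa _ _ _
      have hua : D.flip u a = v := by
        rw [flip, Function.update_idem, ← hva, Function.update_eq_self]
      have hux : u x = false := by rw [← hvx]; exact Function.update_of_ne hxa _ _
      rw [h1, hη u x hxS hux, mul_assoc, hg u x a hxa hux (Function.update_self _ _ _), hua,
        mul_assoc]
    · rw [if_neg hva, if_neg hva]
      exact hη v x hxS hvx

lemma standardSign_flip {v : D.Vertex} {x y : Fin D.n} (h : v x = false) :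
    D.standardSign (D.flip v x) y =
      if x < y then -D.standardSign v y else D.standardSign v y := by
  unfold standardSign
  split_ifs with hxy
  · have : (Finset.univ.filter fun z => z < y ∧ D.flip v x z = true) =
        insert x (Finset.univ.filter fun z => z < y ∧ v z = true) := by
      ext z
      by_cases hz : z = x
      · subst hz; simp [hxy]
      · simp [hz]
    rw [this, Finset.card_insert_of_notMem (by simp [h]), pow_succ, mul_neg_one]
  · congr 2
    ext z
    by_cases hz : z = x
    · subst hz; simp [hxy]
    · simp [hz]

lemma standardSign_face {v : D.Vertex} {x y : Fin D.n} (hxy : x ≠ y) (hx : v x = false)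
    (hy : v y = false) : D.standardSign v x * D.standardSign (D.flip v x) y =
      -(D.standardSign v y * D.standardSign (D.flip v y) x) := by
  rw [standardSign_flip hx, standardSign_flip hy]
  obtain h | h := hxy.lt_or_gt
  · rw [if_pos h, if_neg h.not_gt, mul_neg, mul_comm]
  · rw [if_pos h, if_neg h.not_gt, mul_neg, neg_neg, mul_comm]

open Classical in
/-- The sign by which the nested system differs from Khovanov's on an edge of the cube after
applying the maps `phi`. -/
def edgeSign (v : D.Vertex) (x : Fin D.n) : ℤˣ :=
  if h : v x = false then (exists_phi_comp_nestedSaddle (merges_flip h)).choose else 1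

lemma phi_nestedSaddle {v : D.Vertex} {x : Fin D.n} (h : v x = false) (a : D.Space v) :
    D.phi (D.flip v x) (D.nestedSaddle x v (D.flip v x) a) =
      ((edgeSign v x : ℤ) : R) • D.khSaddle x v (D.flip v x) (D.phi v a) := by
  have := (exists_phi_comp_nestedSaddle (merges_flip h)).choose_spec
  rw [edgeSign, dif_pos h]
  exact LinearMap.congr_fun this a

/-- `phi` is invertible, and the augmentation of `k` on 1 ⊗ ... ⊗ 1 is a nonzero integer, so it
detects the sign. -/
lemma eq_iff_of_phi_comp {v u : D.Vertex} {f g k : D.Space v →ₗ[R] D.Space u} {σ τ : ℤˣ}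
    (hf : ∀ a, D.phi u (f a) = ((σ : ℤ) : R) • k (D.phi v a))
    (hg : ∀ a, D.phi u (g a) = ((τ : ℤ) : R) • k (D.phi v a))
    (hk : aug u (k (mono v 0)) ≠ 0) : f = g ↔ σ = τ := by
  constructor
  · rintro rfl
    have := congrArg (aug u) ((hf (mono v 0)).symm.trans (hg (mono v 0)))
    rw [phi_one, aug_smul, aug_smul, Polynomial.eval_intCast, Polynomial.eval_intCast] at this
    exact Units.ext (by simpa using mul_right_cancel₀ hk this)
  · rintro rfl
    ext1
    refine MultilinearMap.ext fun a => ?_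
    rw [LinearMap.compMultilinearMap_apply, LinearMap.compMultilinearMap_apply, ← phi_phi (f _),
      hf, ← hg, phi_phi]

/-! ### Commuting and anticommuting faces of the nested cube. -/

section Face

variable {v : D.Vertex} {x y : Fin D.n}

lemma khSaddle_face (hxy : x ≠ y) (hx : v x = false) (hy : v y = false) :
    D.khSaddle y (D.flip v x) (D.flip (D.flip v x) y) ∘ₗ D.khSaddle x v (D.flip v x) =
      D.khSaddle x (D.flip v y) (D.flip (D.flip v x) y) ∘ₗ D.khSaddle y v (D.flip v y) := by
  refine khSaddle_comm (merges_flip hx) (merges_flip ?_) (merges_flip hy) ?_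
  · rwa [flip_apply_of_ne hxy]
  · rw [flip_comm hxy]
    exact merges_flip (by rwa [flip_apply_of_ne hxy.symm])

lemma phi_nestedSaddle_nestedSaddle (hxy : x ≠ y) (hx : v x = false) (hy : v y = false)
    (a : D.Space v) :
    D.phi _ (D.nestedSaddle y (D.flip v x) (D.flip (D.flip v x) y)
      (D.nestedSaddle x v (D.flip v x) a)) =
      (((edgeSign v x * edgeSign (D.flip v x) y : ℤˣ) : ℤ) : R) •
        D.khSaddle y (D.flip v x) (D.flip (D.flip v x) y)
          (D.khSaddle x v (D.flip v x) (D.phi v a)) := by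
  rw [phi_nestedSaddle (by rwa [flip_apply_of_ne hxy]), phi_nestedSaddle hx, map_smul, smul_smul]
  push_cast
  rw [mul_comm]

lemma face_iff (hxy : x ≠ y) (hx : v x = false) (hy : v y = false) :
    (D.FaceCommutes v x y ↔ edgeSign v x * edgeSign (D.flip v x) y =
      edgeSign v y * edgeSign (D.flip v y) x) ∧
    (D.FaceAnticommutes v x y ↔ edgeSign v x * edgeSign (D.flip v x) y =
      -(edgeSign v y * edgeSign (D.flip v y) x)) := by
  have h1 := phi_nestedSaddle_nestedSaddle hxy hx hy
  have h2 := phi_nestedSaddle_nestedSaddle hxy.symm hy hx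
  rw [← flip_comm hxy] at h2
  have hk := khSaddle_face hxy hx hy
  have hk' := fun a => LinearMap.congr_fun hk a
  simp only [LinearMap.comp_apply] at hk'
  simp only [← hk'] at h2
  have hne := aug_khSaddle_khSaddle_ne (merges_flip hx)
    (merges_flip (v := D.flip v x) (x := y) (by rwa [flip_apply_of_ne hxy]))
  refine ⟨eq_iff_of_phi_comp (k := _ ∘ₗ _) h1 h2 hne,
    eq_iff_of_phi_comp (k := _ ∘ₗ _) h1 (fun a => ?_) hne⟩
  rw [LinearMap.neg_apply, map_neg, LinearMap.comp_apply, h2, Units.val_neg, Int.cast_neg]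
  exact (neg_smul _ _).symm

end Face

lemma units_eq_or_eq_neg (a b : ℤˣ) : a = b ∨ a = -b := by
  obtain rfl | rfl := Int.units_eq_one_or a <;> obtain rfl | rfl := Int.units_eq_one_or b <;> simp

lemma units_ne_neg (a : ℤˣ) : a ≠ -a := by
  obtain rfl | rfl := Int.units_eq_one_or a <;> decide

lemma xor_face {v : D.Vertex} {x y : Fin D.n} (hxy : x ≠ y) (hx : v x = false)
    (hy : v y = false) : Xor (D.FaceCommutes v x y) (D.FaceAnticommutes v x y) := by
  obtain ⟨h1, h2⟩ := face_iff hxy hx hy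
  rw [h1, h2]
  obtain h | h := units_eq_or_eq_neg (edgeSign v x * edgeSign (D.flip v x) y)
    (edgeSign v y * edgeSign (D.flip v y) x)
  · exact Or.inl ⟨h, h ▸ units_ne_neg _⟩
  · refine Or.inr ⟨h, fun h' => units_ne_neg _ (h'.symm.trans h)⟩

/-- By `face_iff`, twisting by `edgeSign` turns the two cases into the single condition that holds
for the standard signs. -/
lemma isSignAssignment_iff {ε : D.Vertex → Fin D.n → ℤˣ} : D.IsSignAssignment ε ↔
    ∀ v x y, x ≠ y → v x = false → v y = false →
      ε v x * ε (D.flip v x) y * (edgeSign v x * edgeSign (D.flip v x) y) =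
        -(ε v y * ε (D.flip v y) x * (edgeSign v y * edgeSign (D.flip v y) x)) := by
  refine forall₃_congr fun v x y => forall₃_congr fun hxy hx hy => ?_
  obtain ⟨h1, h2⟩ := face_iff hxy hx hy
  rw [h1, h2]
  generalize ε v x * ε (D.flip v x) y = a, ε v y * ε (D.flip v y) x = b,
    edgeSign v x * edgeSign (D.flip v x) y = c, edgeSign v y * edgeSign (D.flip v y) x = d
  revert a b c d
  decide

lemma exists_isSignAssignment (D : LinkDiagram) : ∃ ε, D.IsSignAssignment ε := by
  refine ⟨fun v x => D.standardSign v x * edgeSign v x, isSignAssignment_iff.2 ?_⟩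
  intro v x y hxy hx hy
  have h := standardSign_face hxy hx hy
  have key : ∀ a b : ℤˣ, ∀ c d : ℤˣ, a * c * (b * d) * (c * d) = a * b := by decide
  rw [key, key, h]

/-! ### The differential -/

variable {f : ∀ (_ : Fin D.n) (v w : D.Vertex), D.Space v →ₗ[R] D.Space w}
  {ε : D.Vertex → Fin D.n → ℤˣ}

lemma diff_incl (r : ℤ) (v : D.VertexIn r) (a : D.Space v.1) :
    D.diff f ε r (D.incl r v a) = ∑ x : Fin D.n, if h : v.1 x = false then
      ((ε v.1 x : ℤ) : R) • D.incl (r + 1) (D.flipIn v x h) (f x v.1 (D.flipIn v x h).1 a) else 0 := by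
  rw [diff, incl, DirectSum.toModule_lof, LinearMap.sum_apply]
  refine Finset.sum_congr rfl fun x _ => ?_
  split_ifs <;> rfl

lemma chain_hom_ext {r : ℤ} {M : Type*} [AddCommMonoid M] [Module R M] {f g : D.Chain r →ₗ[R] M}
    (h : ∀ v a, f (D.incl r v a) = g (D.incl r v a)) : f = g :=
  DirectSum.linearMap_ext R fun v => LinearMap.ext (h v)

/-- Flipping two crossings in either order gives equal but not definitionally equal vertices. A
family over all vertices avoids casts between their modules. -/
lemma incl_congr {r : ℤ} {v w : D.VertexIn r} (h : v = w) (g : ∀ u : D.Vertex, D.Space u) :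
    D.incl r v (g v.1) = D.incl r w (g w.1) := by
  rw [h]

lemma isComplex_of_faces (h : ∀ v x y, x ≠ y → v x = false → v y = false → ∀ a,
    (((ε v x * ε (D.flip v x) y : ℤˣ) : ℤ) : R) •
      f y (D.flip v x) (D.flip (D.flip v x) y) (f x v (D.flip v x) a) +
    (((ε v y * ε (D.flip v y) x : ℤˣ) : ℤ) : R) •
      f x (D.flip v y) (D.flip (D.flip v x) y) (f y v (D.flip v y) a) = 0) :
    D.IsComplex f ε := by
  classical
  intro r
  refine chain_hom_ext fun v a => ?_
  -- The contribution of the path flipping `p.1` and then `p.2`, extended by 0 to pairs that are not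
  -- paths. Swapping the pair cancels the terms face by face, and the diagonal vanishes.
  let T : Fin D.n × Fin D.n → D.Chain (r + 1 + 1) := fun p =>
    if hx : v.1 p.1 = false then
      if hy : (D.flipIn v p.1 hx).1 p.2 = false then
        (((ε v.1 p.1 * ε (D.flip v.1 p.1) p.2 : ℤˣ) : ℤ) : R) •
          D.incl (r + 1 + 1) (D.flipIn (D.flipIn v p.1 hx) p.2 hy)
            (f p.2 (D.flipIn v p.1 hx).1 (D.flipIn (D.flipIn v p.1 hx) p.2 hy).1
              (f p.1 v.1 (D.flipIn v p.1 hx).1 a)) else 0 else 0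
  have hT : (D.diff f ε (r + 1) ∘ₗ D.diff f ε r) (D.incl r v a) = ∑ p, T p := by
    rw [LinearMap.comp_apply, diff_incl, map_sum, Fintype.sum_prod_type]
    refine Finset.sum_congr rfl fun x _ => ?_
    by_cases hx : v.1 x = false
    · rw [dif_pos hx, map_smul, diff_incl, Finset.smul_sum]
      refine Finset.sum_congr rfl fun y _ => ?_
      simp only [T, dif_pos hx]
      split_ifs with hy
      · rw [smul_smul, ← Int.cast_mul, ← Units.val_mul]
        rfl
      · rw [smul_zero]
    · rw [dif_neg hx, map_zero]
      exact (Finset.sum_eq_zero fun y _ => dif_neg hx).symm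
  rw [hT, LinearMap.zero_apply]
  refine Finset.sum_involution (fun p _ => p.swap) ?_ ?_ (fun _ _ => Finset.mem_univ _)
    (fun _ _ => Prod.swap_swap _)
  · rintro ⟨x, y⟩ -
    by_cases hxy : x = y
    · subst hxy
      simp [T, flipIn]
    by_cases hx : v.1 x = false
    swap
    · have : D.flip v.1 y x ≠ false := by rwa [flip_apply_of_ne (Ne.symm hxy)]
      simp [T, flipIn, hx, hxy]
    by_cases hy : v.1 y = false
    swap
    · simp [T, flipIn, hy, Ne.symm hxy]
    have hyx : (D.flipIn v x hx).1 y = false := (flip_apply_of_ne hxy).trans hy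
    have hxy' : (D.flipIn v y hy).1 x = false := (flip_apply_of_ne (Ne.symm hxy)).trans hx
    have hw : D.flipIn (D.flipIn v y hy) x hxy' = D.flipIn (D.flipIn v x hx) y hyx :=
      Subtype.ext (flip_comm (Ne.symm hxy))
    have h1 := incl_congr hw fun u =>
      f x (D.flipIn v y hy).1 u (f y v.1 (D.flipIn v y hy).1 a)
    simp only [T, Prod.swap, dif_pos hx, dif_pos hy, dif_pos hyx, dif_pos hxy']
    refine (congrArg₂ (· + ·) rfl (congrArg _ h1)).trans ?_
    rw [← map_smul (D.incl _ _), ← map_smul (D.incl _ _), ← map_add]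
    exact (congrArg _ (h v.1 x y hxy hx hy a)).trans (map_zero _)
  · rintro ⟨x, y⟩ - hne h'
    obtain rfl : y = x := congrArg Prod.fst h'
    refine hne ?_
    simp [T, flipIn]

lemma isComplex_khSaddle (D : LinkDiagram) : D.IsComplex D.khSaddle D.standardSign := by
  refine isComplex_of_faces fun v x y hxy hx hy a => ?_
  have h := LinearMap.congr_fun (khSaddle_face hxy hx hy) a
  rw [LinearMap.comp_apply, LinearMap.comp_apply] at h
  rw [h, standardSign_face hxy hx hy, Units.val_neg, Int.cast_neg]
  exact (congrArg (· + _) (neg_smul _ _)).trans (neg_add_cancel _)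

lemma IsSignAssignment.isComplex (hε : D.IsSignAssignment ε) :
    D.IsComplex D.nestedSaddle ε := by
  refine isComplex_of_faces fun v x y hxy hx hy a => ?_
  obtain ⟨h1, h2⟩ := hε v x y hxy hx hy
  have k1 : ∀ b c : ℤˣ, b * c = -1 → b = -c := by decide
  have k2 : ∀ b c : ℤˣ, b * c = 1 → b = c := by decide
  obtain ⟨hf, -⟩ | ⟨hf, -⟩ := xor_face hxy hx hy
  · have h := LinearMap.congr_fun hf a
    rw [LinearMap.comp_apply, LinearMap.comp_apply] at h
    rw [h, k1 _ _ (h1 hf), Units.val_neg, Int.cast_neg]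
    exact (congrArg (· + _) (neg_smul _ _)).trans (neg_add_cancel _)
  · have h := LinearMap.congr_fun hf a
    rw [LinearMap.neg_apply, LinearMap.comp_apply, LinearMap.comp_apply] at h
    rw [h, k2 _ _ (h2 hf)]
    exact (congrArg (· + _) (smul_neg _ _)).trans (neg_add_cancel _)

/-- The endomorphism of a chain group that is `η v • phi v` on the summand of `v`. -/
def chainPhi (η : D.Vertex → ℤˣ) (r : ℤ) : D.Chain r →ₗ[R] D.Chain r :=
  DirectSum.toModule R _ _ fun v => ((η v.1 : ℤ) : R) • (D.incl r v ∘ₗ D.phi v.1)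

lemma chainPhi_incl (η : D.Vertex → ℤˣ) (r : ℤ) (v : D.VertexIn r) (a : D.Space v.1) :
    chainPhi η r (D.incl r v a) = ((η v.1 : ℤ) : R) • D.incl r v (D.phi v.1 a) := by
  rw [chainPhi, incl, DirectSum.toModule_lof]
  rfl

lemma intCast_units_mul_self (a : ℤˣ) : ((a : ℤ) : R) * ((a : ℤ) : R) = 1 := by
  rw [← Int.cast_mul, ← Units.val_mul, Int.units_mul_self]
  simp

lemma chainPhi_chainPhi (η : D.Vertex → ℤˣ) (r : ℤ) (a : D.Chain r) :
    chainPhi η r (chainPhi η r a) = a := by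
  suffices h : chainPhi η r ∘ₗ chainPhi η r = LinearMap.id from LinearMap.congr_fun h a
  refine chain_hom_ext fun v a => ?_
  rw [LinearMap.comp_apply, chainPhi_incl, map_smul, chainPhi_incl, phi_phi, smul_smul,
    intCast_units_mul_self, one_smul, LinearMap.id_apply]

/-- On each edge of the cube the hypothesis on η absorbs the sign of the nested differential, the
discrepancy `edgeSign` and the standard sign. -/
lemma diff_chainPhi {η : D.Vertex → ℤˣ}
    (hη : ∀ v x, v x = false →
      η (D.flip v x) = η v * (ε v x * edgeSign v x * D.standardSign v x)) (r : ℤ) :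
    D.diff D.khSaddle D.standardSign r ∘ₗ chainPhi η r =
      chainPhi η (r + 1) ∘ₗ D.diff D.nestedSaddle ε r := by
  refine chain_hom_ext fun v a => ?_
  rw [LinearMap.comp_apply, LinearMap.comp_apply, chainPhi_incl, map_smul, diff_incl, diff_incl,
    map_sum, Finset.smul_sum]
  refine Finset.sum_congr rfl fun x _ => ?_
  split_ifs with hx
  · rw [map_smul, chainPhi_incl]
    have hphi : D.phi (D.flipIn v x hx).1 (D.nestedSaddle x v.1 (D.flipIn v x hx).1 a) =
        ((edgeSign v.1 x : ℤ) : R) • D.khSaddle x v.1 (D.flipIn v x hx).1 (D.phi v.1 a) :=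
      phi_nestedSaddle hx a
    have hη' : η (D.flipIn v x hx).1 =
        η v.1 * (ε v.1 x * edgeSign v.1 x * D.standardSign v.1 x) := hη v.1 x hx
    rw [hphi, hη', map_smul, smul_smul, smul_smul, smul_smul]
    congr 1
    simp only [← Int.cast_mul, ← Units.val_mul]
    congr 2
    generalize η v.1 = a, ε v.1 x = b, edgeSign v.1 x = c, D.standardSign v.1 x = d
    revert a b c d
    decide
  · simp

lemma cubeComplex_d (h : D.IsComplex f ε) (r : ℤ) :
    (D.cubeComplex f ε h).d r (r + 1) = ModuleCat.ofHom (D.diff f ε r) :=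
  CochainComplex.of_d (fun r => ModuleCat.of R (D.Chain r))
    (fun r => ModuleCat.ofHom (D.diff f ε r)) r

lemma exists_iso (hKh : D.IsComplex D.khSaddle D.standardSign)
    (hε : D.IsComplex D.nestedSaddle ε) {η : D.Vertex → ℤˣ}
    (hη : ∀ v x, v x = false →
      η (D.flip v x) = η v * (ε v x * edgeSign v x * D.standardSign v x)) :
    ∃ Φ : D.nestedComplex ε hε ≅ D.khComplex hKh, ∀ (r : ℤ) (v : D.VertexIn r) (a : D.Space v.1),
      (Φ.hom.f r).hom (D.incl r v a) = ((η v.1 : ℤ) : R) • D.incl r v (D.phi v.1 a) := by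
  refine ⟨HomologicalComplex.Hom.isoOfComponents (fun r => LinearEquiv.toModuleIso
    (LinearEquiv.ofInvolutive (chainPhi η r) (chainPhi_chainPhi η r))) ?_,
    fun r v a => chainPhi_incl η r v a⟩
  rintro r _ rfl
  change _ ≫ (D.cubeComplex _ _ hKh).d r (r + 1) = (D.cubeComplex _ _ hε).d r (r + 1) ≫ _
  rw [cubeComplex_d, cubeComplex_d]
  exact ModuleCat.hom_ext (diff_chainPhi hη r)

/-- Both ε · `edgeSign` and the standard signs change sign between the two paths of a face, so their
product is a cocycle. -/
lemma IsSignAssignment.exists_eq_mul (hε : D.IsSignAssignment ε) : ∃ η : D.Vertex → ℤˣ,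
    ∀ v x, v x = false →
      η (D.flip v x) = η v * (ε v x * edgeSign v x * D.standardSign v x) := by
  refine exists_eq_mul_of_cocycle fun v x y hxy hx hy => ?_
  have h1 := isSignAssignment_iff.1 hε v x y hxy hx hy
  have h2 := standardSign_face hxy hx hy
  rw [mul_mul_mul_comm, mul_mul_mul_comm (ε v x), h1, h2, neg_mul_neg, mul_mul_mul_comm (ε v y),
    mul_mul_mul_comm (ε v y * _)]

end LinkDiagram
end NestedKhovanov
end

/-! ### The main theorem. -/

open NestedKhovanov.LinkDiagram in
theorem theorem1 (D : NestedKhovanov.LinkDiagram) :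
    (∀ v x y, x ≠ y → v x = false → v y = false →
      Xor (D.FaceCommutes v x y) (D.FaceAnticommutes v x y)) ∧
    (∃ ε, D.IsSignAssignment ε) ∧
    ∃ hKh : D.IsComplex D.khSaddle D.standardSign,
      ∀ ε, D.IsSignAssignment ε →
        ∃ hε : D.IsComplex D.nestedSaddle ε,
          ∃ Φ : D.nestedComplex ε hε ≅ D.khComplex hKh,
            ∃ η : D.Vertex → ℤˣ, ∀ (r : ℤ) (v : D.VertexIn r) (a : D.Space v.1),
              (Φ.hom.f r).hom (D.incl r v a) =
                ((η v.1 : ℤ) : NestedKhovanov.R) • D.incl r v (D.phi v.1 a) := by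
  refine ⟨fun v x y hxy hx hy => xor_face hxy hx hy, exists_isSignAssignment D,
    isComplex_khSaddle D, fun ε hε => ⟨hε.isComplex, ?_⟩⟩
  obtain ⟨η, hη⟩ := hε.exists_eq_mul
  obtain ⟨Φ, hΦ⟩ := exists_iso (isComplex_khSaddle D) hε.isComplex hη
  exact ⟨Φ, η, hΦ⟩
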